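/- **Setting.** Let $\theta$ be a finite positive Borel measure on $[-1,1]$ whose support is infinite, let $a_1,\dots,a_m\in[-1,1]$ with $\theta(\{a_k\})=0$, let $N_k\ge 0$ be integers, and let $M_{k,i}\ge 0$ $(0\le i<N_k)$, $M_{k,N_k}>0$. Put $$\langle f,g\rangle=\int_{-1}^1 fg\,d\theta+\sum_{k=1}^m\sum_{i=0}^{N_k}M_{k,i}f^{(i)}(a_k)g^{(i)}(a_k),$$ where derivatives are those of functions on $[-1,1]$ (one-sided at $\pm1$). Let $\widehat q_n$ $(n\ge0)$ be the polynomials of degree $n$ with positive leading coefficient that are orthonormal for $\langle\cdot,\cdot\rangle$. For $1\le p<\infty$ let $\mathfrak R_p$ be the set of $f$ with $\int_{-1}^1|f|^p\,d\theta<\infty$ such that $f^{(i)}(a_k)$ exists for $0\le i\le N_k$, $1\le k\le m$; for $f\in\mathfrak R_p$ put $c_k(f)=\langle f,\widehat q_k\rangle$. Let $N_k^*=N_k+1$ if $N_k$ is odd and $N_k^*=N_k+2$ if $N_k$ is even, $N=\sum_k N_k^*$, $w_N(x)=\prod_k(x-a_k)^{N_k^*}$, $\pi_{N+1}(x)=\int_{-1}^x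 w_N(t)\,dt$, and let $d_{n,j}$ be the coefficients of the recurrence relation $$\pi_{N+1}\widehat q_n=\sum_{j=0}^{N+1}d_{n+j,j}\,\widehat q_{n+j}+\sum_{j=1}^{N+1}d_{n,j}\,\widehat q_{n-j},$$ that is, $d_{n,j}=\langle \pi_{N+1}\widehat q_n,\widehat q_{n-j}\rangle$ for $j\le n$ and $d_{n,j}=0$ for $n<j$. Let $\varepsilon_m=(-1,1)\setminus\{a_1,\dots,a_m\}$. A point $x$ is called a Lebesgue point of $f$ if $\lim_{r\to0+}\frac1r\int_{[x-r,x+r]}|f(t)-f(x)|\,d\theta(t)=0$. **Theorem.** Suppose that $h$ is a real function with $|\widehat q_k(t)|\le h(t)$ for all $k\ge0$ and $t\in\varepsilon_m$, and that $$\sum_{j=1}^{N+1}j\sum_{l=0}^{N+1}\sum_{s=0}^\infty\bigl(|d_{s+j,j}-d_{s+j+l,j}|+|d_{s+l,l}-d_{s+j+l,l}|\bigr)<\infty.$$ Let $(\phi_k)_{k\ge0}$ be a real sequence with $\phi_0=1$ that is quasiconvex, i.e. $\sum_{k\ge0}(k+1)|\phi_k-2\phi_{k+1}+\phi_{k+2}|<\infty$,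 and satisfies $\phi_k=O(1/\ln k)$. Let $1\le p<\infty$ and let $f\in\mathfrak R_p$ satisfy $$\int_{-1}^1|f|^p|h|^p\,d\theta<\infty,\qquad \int_{-1}^1|h|^p\,d\theta<\infty.$$ (i) The series $\sum_{k=0}^\infty\phi_kc_k(f)\widehat q_k(x)$ converges at every Lebesgue point $x\in\varepsilon_m$ of $f$ near which $h$ is bounded; moreover (without any local boundedness of $h$) it converges at almost every $x\in\varepsilon_m$ with respect to Lebesgue measure. (ii) If, in addition, $f$ is continuous on $[-1,1]$, $h$ is locally bounded on $\varepsilon_m$, and $d\theta(x)=\omega(x)\,dx$ with $\omega\ge0$ continuous on $\varepsilon_m$, then the series converges uniformly on every compact subset $K\subset\varepsilon_m$. -/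

import Mathlib

open MeasureTheory Set Filter Topology Asymptotics

noncomputable section

/-- Data of a continuous-discrete Sobolev inner product on `[-1, 1]`: a finite positive Borel
measure `θ` carried by `[-1, 1]` with infinitely many points of increase, mass points
`a k ∈ [-1, 1]` with `θ {a k} = 0`, the orders `ord k` (written `N_k`) and the weights `M k i`. -/
structure SobolevData where
  m : ℕ
  θ : Measure ℝ
  finite : IsFiniteMeasure θ
  carried : θ (Icc (-1 : ℝ) 1)ᶜ = 0
  infinite_support : θ.support.Infinite
  a : Fin m → ℝ
  a_mem : ∀ k, a k ∈ Icc (-1 : ℝ) 1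
  θ_a : ∀ k, θ {a k} = 0
  ord : Fin m → ℕ
  M : Fin m → ℕ → ℝ
  M_nonneg : ∀ k, ∀ i < ord k, 0 ≤ M k i
  M_pos : ∀ k, 0 < M k (ord k)

/-- The `i`-th derivative `f^{(i)}(x)` of a function on `[-1, 1]` (one-sided at the endpoints). -/
def derivI (i : ℕ) (f : ℝ → ℝ) (x : ℝ) : ℝ :=
  iteratedDerivWithin i f (Icc (-1 : ℝ) 1) x

/-- `f^{(i)}(x)` exists, for a function on `[-1, 1]`: `f^{(i-1)}` exists near `x` in `[-1, 1]` and
is differentiable at `x`. -/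
def DerivExists (f : ℝ → ℝ) : ℕ → ℝ → Prop
  | 0, _ => True
  | i + 1, x => (∀ᶠ y in 𝓝[Icc (-1 : ℝ) 1] x, DerivExists f i y) ∧
      DifferentiableWithinAt ℝ (derivI i f) (Icc (-1 : ℝ) 1) x

/-- `φ` is quasiconvex (normalized by `φ 0 = 1`). -/
def IsQuasiconvex (φ : ℕ → ℝ) : Prop :=
  φ 0 = 1 ∧ Summable fun k : ℕ => ((k : ℝ) + 1) * |φ k - 2 * φ (k + 1) + φ (k + 2)|

/-- `x` is a Lebesgue point of `f` for the measure `μ` on the line: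
`(1/r) ∫_{x-r}^{x+r} |f(t) - f(x)| dμ(t) → 0` as `r → 0+`. -/
def IsLebesguePoint (μ : Measure ℝ) (f : ℝ → ℝ) (x : ℝ) : Prop :=
  Tendsto (fun r : ℝ => r⁻¹ * ∫ t in Icc (x - r) (x + r), |f t - f x| ∂μ) (𝓝[>] 0) (𝓝 0)

namespace SobolevData

variable (S : SobolevData)

/-- The inner product `⟨f, g⟩ = ∫ f g dθ + ∑_k ∑_{i ≤ N_k} M_{k,i} f^{(i)}(a_k) g^{(i)}(a_k)`. -/
def ip (f g : ℝ → ℝ) : ℝ :=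
  (∫ x, f x * g x ∂S.θ) +
    ∑ k : Fin S.m, ∑ i ∈ Finset.range (S.ord k + 1),
      S.M k i * derivI i f (S.a k) * derivI i g (S.a k)

/-- `q n` has degree `n` and positive leading coefficient, and the `q n` are orthonormal. -/
def IsOrthonormalSystem (q : ℕ → Polynomial ℝ) : Prop :=
  (∀ n, (q n).natDegree = n ∧ 0 < (q n).leadingCoeff) ∧
    ∀ n k, S.ip (fun x => (q n).eval x) (fun x => (q k).eval x) = if n = k then 1 else 0

/-- The class `R_p`: `∫ |f|^p dθ < ∞` and `f^{(i)}(a_k)` exists for `i ≤ N_k`. -/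
def MemR (p : ℝ) (f : ℝ → ℝ) : Prop :=
  MemLp f (ENNReal.ofReal p) S.θ ∧ ∀ k, ∀ i ≤ S.ord k, DerivExists f i (S.a k)

/-- Fourier coefficient `c_k(f) = ⟨f, q_k⟩`. -/
def coeff (q : ℕ → Polynomial ℝ) (f : ℝ → ℝ) (k : ℕ) : ℝ :=
  S.ip f (fun x => (q k).eval x)

/-- Partial sum, over `k < n`, of the multiplier series `∑ φ_k c_k(f) q_k(x)`. -/
def multSum (q : ℕ → Polynomial ℝ) (φ : ℕ → ℝ) (f : ℝ → ℝ) (n : ℕ) (x : ℝ) : ℝ :=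
  ∑ k ∈ Finset.range n, φ k * S.coeff q f k * (q k).eval x

/-- `N_k^*`: the least even integer greater than `N_k`. -/
def ordStar (k : Fin S.m) : ℕ :=
  if Odd (S.ord k) then S.ord k + 1 else S.ord k + 2

/-- `N = ∑ N_k^*`. -/
def N : ℕ := ∑ k, S.ordStar k

/-- `w_N(x) = ∏ (x - a_k)^{N_k^*}`. -/
def w (x : ℝ) : ℝ := ∏ k, (x - S.a k) ^ S.ordStar k

/-- `π_{N+1}(x) = ∫_{-1}^x w_N(t) dt`. -/
def primW (x : ℝ) : ℝ := ∫ t in (-1 : ℝ)..x, S.w t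

/-- The recurrence coefficients `d_{n,j}`: the coefficient of `q_{n-j}` in the expansion
`π_{N+1} q_n = ∑_{j=0}^{N+1} d_{n+j,j} q_{n+j} + ∑_{j=1}^{N+1} d_{n,j} q_{n-j}`,
with `d_{n,j} = 0` for `n < j`. -/
def recCoeff (q : ℕ → Polynomial ℝ) (n j : ℕ) : ℝ :=
  if j ≤ n then S.ip (fun x => S.primW x * (q n).eval x) (fun x => (q (n - j)).eval x) else 0

/-- The open set `ε_m = (-1, 1) \ {a_1, …, a_m}`. -/
def eps : Set ℝ := Ioo (-1 : ℝ) 1 \ range S.a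

end SobolevData

end

/-! The derivative `w` of π = π_{N+1} vanishes at a_k to order N_k^* > N_k. By Leibniz,
(πP)^{(i)}(a_k) = π(a_k) P^{(i)}(a_k) for i ≤ N_k, so multiplication by π is symmetric for the
Sobolev product. In the basis q_n it is therefore a symmetric banded matrix, and the hypothesis on
d_{n,j} says that its diagonals have bounded variation.

For such a matrix, commuting π once past the truncated sum (a Christoffel–Darboux argument) gives
|π(t) - π(x)| |∑_{i<n} q_i(t) q_i(x)| ≤ C h(t) h(x). Commuting twice gives the same bound for |π(t)
- π(x)|² times the Fejér sum with weights n - i (`exists_kernel_bounds`). The exponents N_k^* are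
even, so π is monotone, and |π(t) - π(x)| ≥ c |t - x| for x in a compact part of ε_m. The kernels
thus behave like min(n, 1/|t-x|) and min(n², 1/|t-x|²), weighted by h. The derivatives of q_n at a_k
obey the same recurrence with spectral value π(a_k) ≠ π(x), and are bounded when M_{k,i} > 0, so the
discrete terms stay bounded.

At a Lebesgue point of f for the measure hθ, the partial sums are therefore o(log n) and their
Cesàro means O(1). Summing by parts twice, quasiconvexity and φ_n = O(1/log n) give convergence. All
of this is uniform on sets of uniform Lebesgue points (`exists_tendstoUniformlyOn_multSum`), and the
claims differ only in where such points come from: local boundedness of h, differentiation of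
measures, or uniform continuity of f. -/

/-! ### Commutator bounds for symmetric banded recurrences on ℤ. -/

theorem summable_int_of_eq_zero_outside {g : ℤ → ℝ} (a b : ℤ)
    (h : ∀ k, k < a ∨ b < k → g k = 0) : Summable g := by
  refine summable_of_ne_finset_zero (s := Finset.Icc a b) fun k hk => h k ?_
  rw [Finset.mem_Icc] at hk
  omega

/-- Commutation of multiplication by a spectral variable with a banded bilinear sum. -/
theorem sub_mul_tsum_eq_sum_tsum {α : ℤ → ℤ → ℝ} {L : ℤ}
    (hsym : ∀ l k, α (-l) (k + l) = α l k) {u v : ℤ → ℝ} {z y : ℝ}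
    (hv0 : ∀ k < 0, v k = 0)
    (hu : ∀ k, z * u k = ∑ l ∈ Finset.Icc (-L) L, α l k * u (k + l))
    (hv : ∀ k, y * v k = ∑ l ∈ Finset.Icc (-L) L, α l k * v (k + l))
    (β : ℤ → ℝ) (n : ℤ) (hβ : ∀ k, n ≤ k → β k = 0) (j : ℤ) :
    (z - y) * ∑' k, β k * u (k + j) * v k =
      ∑ l ∈ Finset.Icc (-L) L,
        ∑' k, (β k * α l (k + j) - β (k + l) * α l k) * u (k + j + l) * v k := by
  -- Every sum is finite: `v` vanishes below 0 and `β` vanishes from `n` on.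
  have hs1 : ∀ l, Summable fun k => β k * α l (k + j) * u (k + j + l) * v k := fun l =>
    summable_int_of_eq_zero_outside 0 n fun k hk => by
      rcases hk with hk | hk
      · rw [hv0 k hk, mul_zero]
      · rw [hβ k hk.le]; ring
  have hs2 : ∀ l, Summable fun k => β k * α l k * u (k + j) * v (k + l) := fun l =>
    summable_int_of_eq_zero_outside (-l) n fun k hk => by
      rcases hk with hk | hk
      · rw [hv0 (k + l) (by omega), mul_zero]
      · rw [hβ k hk.le]; ring
  have hs3 : ∀ l, Summable fun k => β (k + l) * α l k * u (k + j + l) * v k := fun l =>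
    summable_int_of_eq_zero_outside 0 (n - l) fun k hk => by
      rcases hk with hk | hk
      · rw [hv0 k hk, mul_zero]
      · rw [hβ (k + l) (by omega)]; ring
  -- Flipping the sign of `l` and translating the index moves the shift from `v` to `u`; symmetry
  -- returns the same coefficient, now weighted by `β (k + l)`.
  have hshift : ∀ l, ∑' k, β k * α (-l) k * u (k + j) * v (k + -l) =
      ∑' k, β (k + l) * α l k * u (k + j + l) * v k := fun l => by
    rw [← (Equiv.addRight l).tsum_eq]
    refine tsum_congr fun k => ?_
    simp only [Equiv.coe_addRight, hsym]
    rw [show k + l + j = k + j + l by ring, show k + l + -l = k by ring]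
  have hneg : ∑ l ∈ Finset.Icc (-L) L, ∑' k, β k * α l k * u (k + j) * v (k + l) =
      ∑ l ∈ Finset.Icc (-L) L, ∑' k, β k * α (-l) k * u (k + j) * v (k + -l) := by
    refine Finset.sum_nbij' (fun l => -l) (fun l => -l) ?_ ?_ ?_ ?_ ?_
    · intro l hl; rw [Finset.mem_Icc] at *; omega
    · intro l hl; rw [Finset.mem_Icc] at *; omega
    · intro l _; simp
    · intro l _; simp
    · intro l _; simp
  calc (z - y) * ∑' k, β k * u (k + j) * v k
      = ∑' k, (z - y) * (β k * u (k + j) * v k) := tsum_mul_left.symm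
    _ = ∑' k, ((∑ l ∈ Finset.Icc (-L) L, β k * α l (k + j) * u (k + j + l) * v k) -
          ∑ l ∈ Finset.Icc (-L) L, β k * α l k * u (k + j) * v (k + l)) := by
        refine tsum_congr fun k => ?_
        have e : (z - y) * (β k * u (k + j) * v k) =
          β k * (z * u (k + j)) * v k - β k * u (k + j) * (y * v k) := by ring
        rw [e, hu, hv, Finset.mul_sum, Finset.sum_mul, Finset.mul_sum]
        congr 1 <;> exact Finset.sum_congr rfl fun l _ => by ring
    _ = (∑ l ∈ Finset.Icc (-L) L, ∑' k, β k * α l (k + j) * u (k + j + l) * v k) -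
          ∑ l ∈ Finset.Icc (-L) L, ∑' k, β (k + l) * α l k * u (k + j + l) * v k := by
        rw [(summable_sum fun l _ => hs1 l).tsum_sub (summable_sum fun l _ => hs2 l),
          Summable.tsum_finsetSum fun l _ => hs1 l, Summable.tsum_finsetSum fun l _ => hs2 l,
          hneg, Finset.sum_congr rfl fun l _ => hshift l]
    _ = _ := by
        rw [← Finset.sum_sub_distrib]
        refine Finset.sum_congr rfl fun l _ => ?_
        rw [← (hs1 l).tsum_sub (hs3 l)]
        exact tsum_congr fun k => by ring

theorem abs_tsum_mul_mul_le {γ u v : ℤ → ℝ} {C U V : ℝ} {i : ℤ} (hγ : Summable fun k => |γ k|)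
    (hC : ∑' k, |γ k| ≤ C) (hu : ∀ k, |u k| ≤ U) (hv : ∀ k, |v k| ≤ V) :
    |∑' k, γ k * u (k + i) * v k| ≤ C * U * V := by
  have hU : 0 ≤ U := (abs_nonneg _).trans (hu 0)
  have hV : 0 ≤ V := (abs_nonneg _).trans (hv 0)
  have hle : ∀ k, ‖γ k * u (k + i) * v k‖ ≤ |γ k| * (U * V) := fun k => by
    rw [Real.norm_eq_abs, abs_mul, abs_mul, mul_assoc]
    exact mul_le_mul_of_nonneg_left (mul_le_mul (hu _) (hv _) (abs_nonneg _) hU) (abs_nonneg _)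
  have h1 := tsum_of_norm_bounded (hγ.mul_right (U * V)).hasSum hle
  rw [tsum_mul_right] at h1
  rw [Real.norm_eq_abs] at h1
  calc _ ≤ _ := h1
    _ ≤ C * (U * V) := mul_le_mul_of_nonneg_right hC (mul_nonneg hU hV)
    _ = _ := by ring

theorem summable_abs_shift_sub {g : ℤ → ℝ} (hg : Summable fun k => |g (k + 1) - g k|) (i : ℤ) :
    Summable fun k => |g (k + i) - g k| := by
  have hsh : ∀ i : ℤ, Summable fun k => |g (k + i + 1) - g (k + i)| := fun i =>
    (Equiv.addRight i).summable_iff.mpr hg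
  induction i using Int.induction_on with
  | zero => simp
  | succ i ih =>
    refine Summable.of_nonneg_of_le (fun _ => abs_nonneg _) (fun k => ?_) ((hsh i).add ih)
    rw [← add_assoc]
    exact abs_sub_le _ _ _
  | pred i ih =>
    refine Summable.of_nonneg_of_le (fun _ => abs_nonneg _) (fun k => ?_)
      ((hsh (-i - 1)).add ih)
    have := abs_sub_le (g (k + (-i - 1))) (g (k + (-i - 1) + 1)) (g k)
    rw [abs_sub_comm (g (k + (-i - 1))) (g (k + (-i - 1) + 1))] at this
    rwa [show k + (-(i : ℤ) - 1) + 1 = k + -i by ring] at this ⊢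

theorem exists_abs_le_of_summable_abs_sub {g : ℤ → ℝ}
    (hg : Summable fun k => |g (k + 1) - g k|) : ∃ a, ∀ k, |g k| ≤ a := by
  have hnat : Summable fun k : ℕ => |g (k + 1) - g k| :=
    hg.comp_injective (i := fun k : ℕ => (k : ℤ)) Nat.cast_injective
  have hneg : Summable fun k : ℕ => |g (-(k : ℤ) - 1 + 1) - g (-(k : ℤ) - 1)| :=
    hg.comp_injective (i := fun k : ℕ => -(k : ℤ) - 1) fun a b hab => by
      simp only at hab; omega
  have h1 : ∀ n : ℕ, |g n - g 0| ≤ ∑' k : ℕ, |g (k + 1) - g k| := fun n => by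
    have := Finset.sum_range_sub (fun k : ℕ => g k) n
    simp only [Nat.cast_zero, Nat.cast_add, Nat.cast_one] at this
    rw [← this]
    exact (Finset.abs_sum_le_sum_abs _ _).trans (hnat.sum_le_tsum _ fun _ _ => abs_nonneg _)
  have h2 : ∀ n : ℕ, |g (-n) - g 0| ≤
      ∑' k : ℕ, |g (-(k : ℤ) - 1 + 1) - g (-(k : ℤ) - 1)| := fun n => by
    have := Finset.sum_range_sub (fun k : ℕ => g (-(k : ℤ))) n
    simp only [Nat.cast_zero, Nat.cast_add, Nat.cast_one, neg_zero] at this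
    rw [← this]
    refine (Finset.abs_sum_le_sum_abs _ _).trans ?_
    refine le_trans (Finset.sum_le_sum fun k _ => le_of_eq ?_)
      (hneg.sum_le_tsum (Finset.range n) fun _ _ => abs_nonneg _)
    rw [abs_sub_comm]
    congr 3 <;> ring
  refine ⟨|g 0| + ((∑' k : ℕ, |g (k + 1) - g k|) +
    ∑' k : ℕ, |g (-(k : ℤ) - 1 + 1) - g (-(k : ℤ) - 1)|), fun k => ?_⟩
  have p1 : 0 ≤ ∑' k : ℕ, |g (k + 1) - g k| := tsum_nonneg fun _ => abs_nonneg _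
  have p2 : 0 ≤ ∑' k : ℕ, |g (-(k : ℤ) - 1 + 1) - g (-(k : ℤ) - 1)| :=
    tsum_nonneg fun _ => abs_nonneg _
  have h3 : |g k| ≤ |g 0| + |g k - g 0| := by
    have := abs_add_le (g 0) (g k - g 0)
    rwa [add_sub_cancel] at this
  obtain ⟨n, rfl | rfl⟩ := Int.eq_nat_or_neg k
  · linarith [h1 n]
  · linarith [h2 n]

/-- The product rule splits the difference into the variations of `b`, `a` and `δ`. The first two
are summable. The cutoff `δ` varies only in a window of fixed width about `n`, so its share does not
depend on `n`. The point is that `C` is chosen before `δ` and `n`. -/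
theorem exists_tsum_abs_commutator_le {a b : ℤ → ℝ} (ha : Summable fun k => |a (k + 1) - a k|)
    (hb : Summable fun k => |b (k + 1) - b k|) (i j : ℤ) {R D : ℝ} :
    ∃ C, ∀ (δ : ℤ → ℝ) (n : ℤ), (∀ k, |δ k| ≤ D) →
      (∀ k : ℤ, (k : ℝ) < n - R ∨ n + R < (k : ℝ) → δ (k + i) = δ k) →
      (Summable fun k => |δ k * a k * b (k + j) - δ (k + i) * a (k + i) * b k|) ∧
      ∑' k, |δ k * a k * b (k + j) - δ (k + i) * a (k + i) * b k| ≤ C := by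
  obtain ⟨A, hA⟩ := exists_abs_le_of_summable_abs_sub ha
  obtain ⟨B, hB⟩ := exists_abs_le_of_summable_abs_sub hb
  have hA0 : 0 ≤ A := (abs_nonneg _).trans (hA 0)
  have hB0 : 0 ≤ B := (abs_nonneg _).trans (hB 0)
  have hsa := summable_abs_shift_sub ha i
  have hsb := summable_abs_shift_sub hb j
  set s : ℤ → ℤ → ℝ := fun n k => if |((k - n : ℤ) : ℝ)| ≤ R then 2 * D * (A * B) else 0 with hs
  have hss : ∀ n, Summable (s n) := fun n =>
    summable_int_of_eq_zero_outside (n - ⌈R⌉) (n + ⌈R⌉) fun k hk => by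
      simp only [hs]
      rw [if_neg]
      rw [abs_le, not_and_or, not_le, not_le]
      have := Int.le_ceil R
      rcases hk with hk | hk
      · left
        have : ((k : ℤ) : ℝ) < ((n - ⌈R⌉ : ℤ) : ℝ) := by exact_mod_cast hk
        push_cast at this ⊢; linarith
      · right
        have : ((n + ⌈R⌉ : ℤ) : ℝ) < ((k : ℤ) : ℝ) := by exact_mod_cast hk
        push_cast at this ⊢; linarith
  have hsn : ∀ n, ∑' k, s n k = ∑' k, s 0 k := fun n => by
    rw [← (Equiv.addRight n).tsum_eq]
    refine tsum_congr fun k => ?_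
    simp [hs]
  refine ⟨(D * A) * (∑' k, |b (k + j) - b k|) + (D * B) * (∑' k, |a (k + i) - a k|) +
    ∑' k, s 0 k, fun δ n hδ hloc => ?_⟩
  have hD0 : 0 ≤ D := (abs_nonneg _).trans (hδ 0)
  have hle : ∀ k, |δ k * a k * b (k + j) - δ (k + i) * a (k + i) * b k| ≤
      (D * A) * |b (k + j) - b k| + (D * B) * |a (k + i) - a k| + s n k := fun k => by
    have e : δ k * a k * b (k + j) - δ (k + i) * a (k + i) * b k =
      δ k * a k * (b (k + j) - b k) + δ k * b k * (-(a (k + i) - a k)) +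
        (δ k - δ (k + i)) * (a (k + i) * b k) := by ring
    rw [e]
    refine (abs_add_three _ _ _).trans (add_le_add (add_le_add ?_ ?_) ?_)
    · rw [abs_mul, abs_mul]
      exact mul_le_mul_of_nonneg_right (mul_le_mul (hδ k) (hA k) (abs_nonneg _) hD0)
        (abs_nonneg _)
    · rw [abs_mul, abs_mul, abs_neg]
      exact mul_le_mul_of_nonneg_right (mul_le_mul (hδ k) (hB k) (abs_nonneg _) hD0)
        (abs_nonneg _)
    · simp only [hs]
      split_ifs with hk
      · rw [abs_mul, abs_mul]
        refine mul_le_mul ?_ (mul_le_mul (hA _) (hB _) (abs_nonneg _) hA0)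
          (mul_nonneg (abs_nonneg _) (abs_nonneg _)) (by positivity)
        refine (abs_sub _ _).trans ?_
        linarith [hδ k, hδ (k + i)]
      · rw [hloc k, sub_self, zero_mul, abs_zero]
        rw [abs_le, not_and_or, not_le, not_le] at hk
        push_cast at hk
        rcases hk with hk | hk
        · left; linarith
        · right; linarith
  have hsum := ((hsb.mul_left (D * A)).add (hsa.mul_left (D * B))).add (hss n)
  have hsm := Summable.of_nonneg_of_le (fun _ => abs_nonneg _) hle hsum
  refine ⟨hsm, (hsm.tsum_le_tsum hle hsum).trans (le_of_eq ?_)⟩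
  rw [((hsb.mul_left (D * A)).add (hsa.mul_left (D * B))).tsum_add (hss n),
    (hsb.mul_left (D * A)).tsum_add (hsa.mul_left (D * B)), tsum_mul_left, tsum_mul_left, hsn]

/-- One commutation with the cutoff k < n, whose shift by `l` alters it only within `L` of `n`. -/
theorem exists_dirichlet_bound_int {α : ℤ → ℤ → ℝ} {L : ℤ}
    (hsym : ∀ l k, α (-l) (k + l) = α l k)
    (hBV : ∀ l ∈ Finset.Icc (-L) L, Summable fun k => |α l (k + 1) - α l k|) :
    ∃ C, ∀ (n : ℤ) (u v : ℤ → ℝ) (z y U V : ℝ), (∀ k < 0, v k = 0) →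
      (∀ k, z * u k = ∑ l ∈ Finset.Icc (-L) L, α l k * u (k + l)) →
      (∀ k, y * v k = ∑ l ∈ Finset.Icc (-L) L, α l k * v (k + l)) →
      (∀ k, |u k| ≤ U) → (∀ k, |v k| ≤ V) →
      |(z - y) * ∑' k, (if k < n then 1 else 0) * u k * v k| ≤ C * U * V := by
  have hex : ∀ l, ∃ C, l ∈ Finset.Icc (-L) L → ∀ (δ : ℤ → ℝ) (n : ℤ), (∀ k, |δ k| ≤ 1) →
      (∀ k : ℤ, (k : ℝ) < n - L ∨ n + L < (k : ℝ) → δ (k + l) = δ k) →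
      (Summable fun k => |δ k * 1 * α l (k + 0) - δ (k + l) * 1 * α l k|) ∧
      ∑' k, |δ k * 1 * α l (k + 0) - δ (k + l) * 1 * α l k| ≤ C := fun l => by
    by_cases hl : l ∈ Finset.Icc (-L) L
    · obtain ⟨C, hC⟩ := exists_tsum_abs_commutator_le (a := fun _ => 1) (b := α l)
        (by simp) (hBV l hl) l 0 (R := L) (D := 1)
      exact ⟨C, fun _ => hC⟩
    · exact ⟨0, fun h => absurd h hl⟩
  choose C hC using hex
  refine ⟨∑ l ∈ Finset.Icc (-L) L, C l, fun n u v z y U V hv0 hu hv hU hV => ?_⟩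
  have key := sub_mul_tsum_eq_sum_tsum hsym hv0 hu hv (fun k => if k < n then 1 else 0) n
    (fun k hk => if_neg (by omega)) 0
  simp only [add_zero] at key
  rw [key, Finset.sum_mul, Finset.sum_mul]
  refine (Finset.abs_sum_le_sum_abs _ _).trans (Finset.sum_le_sum fun l hl => ?_)
  obtain ⟨h1, h2⟩ := hC l hl (fun k => if k < n then 1 else 0) n
    (fun k => by split_ifs <;> simp) (fun k hk => by
      rw [Finset.mem_Icc] at hl
      have hk' : k < n - L ∨ n + L < k := by exact_mod_cast hk
      by_cases hkn : k < n
      · rw [if_pos hkn, if_pos (by omega)]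
      · rw [if_neg hkn, if_neg (by omega)])
  simp only [mul_one, add_zero] at h1 h2
  exact abs_tsum_mul_mul_le h1 h2 hU hV

/-- Two commutations. The first replaces the ramp max(n - k, 0) by its difference over a step `j`,
which is bounded by `L` and constant on either side of a window about `n`; this is an admissible
cutoff for the second. -/
theorem exists_fejer_bound_int {α : ℤ → ℤ → ℝ} {L : ℤ}
    (hsym : ∀ l k, α (-l) (k + l) = α l k)
    (hBV : ∀ l ∈ Finset.Icc (-L) L, Summable fun k => |α l (k + 1) - α l k|) :
    ∃ C, ∀ (n : ℤ) (u v : ℤ → ℝ) (z y U V : ℝ), (∀ k < 0, v k = 0) →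
      (∀ k, z * u k = ∑ l ∈ Finset.Icc (-L) L, α l k * u (k + l)) →
      (∀ k, y * v k = ∑ l ∈ Finset.Icc (-L) L, α l k * v (k + l)) →
      (∀ k, |u k| ≤ U) → (∀ k, |v k| ≤ V) →
      |(z - y) ^ 2 * ∑' k, ((max (n - k) 0 : ℤ) : ℝ) * u k * v k| ≤ C * U * V := by
  have hex : ∀ j l, ∃ C, j ∈ Finset.Icc (-L) L → l ∈ Finset.Icc (-L) L →
      ∀ (δ : ℤ → ℝ) (n : ℤ), (∀ k, |δ k| ≤ L) →
      (∀ k : ℤ, (k : ℝ) < n - 2 * L ∨ n + 2 * L < (k : ℝ) → δ (k + l) = δ k) →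
      (Summable fun k => |δ k * α j k * α l (k + j) - δ (k + l) * α j (k + l) * α l k|) ∧
      ∑' k, |δ k * α j k * α l (k + j) - δ (k + l) * α j (k + l) * α l k| ≤ C := fun j l => by
    by_cases hj : j ∈ Finset.Icc (-L) L
    · by_cases hl : l ∈ Finset.Icc (-L) L
      · obtain ⟨C, hC⟩ := exists_tsum_abs_commutator_le (hBV j hj) (hBV l hl) l j
          (R := 2 * L) (D := L)
        exact ⟨C, fun _ _ => hC⟩
      · exact ⟨0, fun _ h => absurd h hl⟩
    · exact ⟨0, fun h => absurd h hj⟩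
  choose C hC using hex
  refine ⟨∑ j ∈ Finset.Icc (-L) L, ∑ l ∈ Finset.Icc (-L) L, C j l,
    fun n u v z y U V hv0 hu hv hU hV => ?_⟩
  set ψ : ℤ → ℝ := fun k => ((max (n - k) 0 : ℤ) : ℝ) with hψ
  have hψ0 : ∀ k, n ≤ k → ψ k = 0 := fun k hk => by
    simp only [hψ]; rw [max_eq_right (by omega), Int.cast_zero]
  have key := sub_mul_tsum_eq_sum_tsum hsym hv0 hu hv ψ n hψ0 0
  simp only [add_zero] at key
  rw [pow_two, mul_assoc, key, Finset.mul_sum, Finset.sum_mul, Finset.sum_mul]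
  refine (Finset.abs_sum_le_sum_abs _ _).trans (Finset.sum_le_sum fun j hj => ?_)
  have hj' := Finset.mem_Icc.mp hj
  have key2 := sub_mul_tsum_eq_sum_tsum hsym hv0 hu hv
    (fun k => (ψ k - ψ (k + j)) * α j k) (n + L)
    (fun k hk => by rw [hψ0 k (by omega), hψ0 (k + j) (by omega)]; ring) j
  have e : ∀ k, (ψ k * α j k - ψ (k + j) * α j k) * u (k + j) * v k =
    (ψ k - ψ (k + j)) * α j k * u (k + j) * v k := fun k => by ring
  simp only [e]
  rw [key2, Finset.sum_mul, Finset.sum_mul]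
  refine (Finset.abs_sum_le_sum_abs _ _).trans (Finset.sum_le_sum fun l hl => ?_)
  have hl' := Finset.mem_Icc.mp hl
  obtain ⟨h1, h2⟩ := hC j l hj hl (fun k => ψ k - ψ (k + j)) n
    (fun k => by
      simp only [hψ]
      rw [← Int.cast_sub, ← Int.cast_abs, Int.cast_le, abs_le]
      omega)
    (fun k hk => by
      have hk' : k < n - 2 * L ∨ n + 2 * L < k := by exact_mod_cast hk
      simp only [hψ]
      rw [← Int.cast_sub, ← Int.cast_sub, Int.cast_inj]
      omega)
  simp only [add_assoc _ j l]
  exact abs_tsum_mul_mul_le h1 h2 hU hV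

/-! ### Transfer to matrices indexed by ℕ. -/

/-- Extension by zero of a sequence to the integers. -/
def extendInt (u : ℕ → ℝ) (k : ℤ) : ℝ := if 0 ≤ k then u k.toNat else 0

/-- The diagonals of a matrix indexed by the natural numbers, extended by zero. -/
def diagInt (A : ℕ → ℕ → ℝ) (l k : ℤ) : ℝ :=
  if 0 ≤ k ∧ 0 ≤ k + l then A k.toNat (k + l).toNat else 0

theorem diagInt_neg {A : ℕ → ℕ → ℝ} (hA : ∀ n m, A n m = A m n) (l k : ℤ) :
    diagInt A (-l) (k + l) = diagInt A l k := by
  unfold diagInt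
  rw [show k + l + -l = k by ring, hA]
  simp only [and_comm]

theorem abs_extendInt_le {u : ℕ → ℝ} {U : ℝ} (hu : ∀ n, |u n| ≤ U) (k : ℤ) :
    |extendInt u k| ≤ U := by
  unfold extendInt
  split_ifs
  · exact hu _
  · simpa using (abs_nonneg _).trans (hu 0)

theorem tsum_mul_extendInt (β : ℤ → ℝ) (n : ℕ) (hβ : ∀ k : ℤ, n ≤ k → β k = 0) (u v : ℕ → ℝ) :
    ∑' k, β k * extendInt u k * extendInt v k = ∑ i ∈ Finset.range n, β i * u i * v i := by
  rw [tsum_eq_sum (s := (Finset.range n).map Nat.castEmbedding), Finset.sum_map]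
  · exact Finset.sum_congr rfl fun i _ => by simp [extendInt]
  · intro k hk
    by_cases hk0 : 0 ≤ k
    · rw [hβ k, zero_mul, zero_mul]
      by_contra hlt
      refine hk (Finset.mem_map.mpr ⟨k.toNat, Finset.mem_range.mpr (by omega), ?_⟩)
      simp [hk0]
    · simp [extendInt, hk0]

theorem extendInt_recurrence {A : ℕ → ℕ → ℝ} {L : ℕ} {u : ℕ → ℝ} {z : ℝ}
    (hband : ∀ n m, m + L < n → A n m = 0)
    (hu : ∀ n, z * u n = ∑ m ∈ Finset.range (n + L + 1), A n m * u m) (k : ℤ) :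
    z * extendInt u k =
      ∑ l ∈ Finset.Icc (-(L : ℤ)) L, diagInt A l k * extendInt u (k + l) := by
  by_cases hk : 0 ≤ k
  · lift k to ℕ using hk
    have e : extendInt u k = u k := by simp [extendInt]
    rw [e, hu]
    symm
    have hsub : (Finset.range (k + L + 1)).image (fun m : ℕ => (m : ℤ) - k) ⊇
        (Finset.Icc (-(L : ℤ)) L).filter fun l => 0 ≤ (k : ℤ) + l := by
      intro l hl
      rw [Finset.mem_filter, Finset.mem_Icc] at hl
      exact Finset.mem_image.mpr ⟨((k : ℤ) + l).toNat, Finset.mem_range.mpr (by omega), by omega⟩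
    rw [← Finset.sum_filter_of_ne (p := fun l => 0 ≤ (k : ℤ) + l), Finset.sum_subset hsub,
      Finset.sum_image]
    · refine Finset.sum_congr rfl fun m _ => ?_
      simp [diagInt, extendInt]
    · intro a _ b _ hab
      simp only at hab; omega
    · intro l hl hl2
      obtain ⟨m, hm, rfl⟩ := Finset.mem_image.mp hl
      rw [Finset.mem_range] at hm
      rw [Finset.mem_filter, Finset.mem_Icc] at hl2
      have : A k m = 0 := hband k m (by omega)
      simp [diagInt, this]
    · intro l _ hne
      by_contra hneg
      exact hne (by simp [diagInt, hneg])
  · have : ∀ l, diagInt A l k = 0 := fun l => by simp [diagInt, hk]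
    simp [this, extendInt, hk]

theorem summable_abs_diagInt_sub {A : ℕ → ℕ → ℝ} {L : ℕ} (hA : ∀ n m, A n m = A m n)
    (hBV : ∀ l ≤ L, Summable fun s => |A (s + l) s - A (s + 1 + l) (s + 1)|) (l : ℤ)
    (hl : l ∈ Finset.Icc (-(L : ℤ)) L) :
    Summable fun k => |diagInt A l (k + 1) - diagInt A l k| := by
  have hpos : ∀ l : ℕ, l ≤ L → Summable fun k => |diagInt A l (k + 1) - diagInt A l k| := by
    intro l hl
    refine Summable.of_nat_of_neg ?_ ?_
    · refine (hBV l hl).congr fun s => ?_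
      have e1 : diagInt A l ((s : ℤ) + 1) = A (s + 1 + l) (s + 1) := by
        rw [hA]; unfold diagInt
        rw [if_pos (by omega)]; congr 1
      have e2 : diagInt A l (s : ℤ) = A (s + l) s := by
        rw [hA]; unfold diagInt
        rw [if_pos (by omega)]; congr 1
      rw [e1, e2, abs_sub_comm]
    -- On the negative half-line the zero extension has a single jump, between -1 and 0; index 0 is
    -- included because both halves contain it.
    · refine summable_of_ne_finset_zero (s := Finset.range 2) fun s hs => ?_
      rw [Finset.mem_range] at hs
      unfold diagInt
      rw [if_neg (by omega), if_neg (by omega)]; simp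
  rw [Finset.mem_Icc] at hl
  by_cases h0 : 0 ≤ l
  · lift l to ℕ using h0
    exact hpos l (by omega)
  · obtain ⟨j, rfl⟩ : ∃ j : ℕ, l = -(j : ℤ) := ⟨(-l).toNat, by omega⟩
    have := (Equiv.addRight (-(j : ℤ))).summable_iff.mpr (hpos j (by omega))
    refine this.congr fun k => ?_
    have e : ∀ k, diagInt A (-(j : ℤ)) k = diagInt A j (k + -j) := fun k => by
      rw [← diagInt_neg hA]
      congr 1; ring
    simp only [Function.comp, Equiv.coe_addRight, e]
    congr 3; ring_nf

/-- Kernel bounds for two sequences satisfying the same symmetric banded recurrence whose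
coefficients have bounded variation along diagonals. -/
theorem exists_kernel_bounds {A : ℕ → ℕ → ℝ} {L : ℕ} (hA : ∀ n m, A n m = A m n)
    (hband : ∀ n m, m + L < n → A n m = 0)
    (hBV : ∀ l ≤ L, Summable fun s => |A (s + l) s - A (s + 1 + l) (s + 1)|) :
    ∃ C : ℝ, ∀ (n : ℕ) (u v : ℕ → ℝ) (z y U V : ℝ),
      (∀ n, z * u n = ∑ m ∈ Finset.range (n + L + 1), A n m * u m) →
      (∀ n, y * v n = ∑ m ∈ Finset.range (n + L + 1), A n m * v m) →
      (∀ k, |u k| ≤ U) → (∀ k, |v k| ≤ V) →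
      |z - y| * |∑ i ∈ Finset.range n, u i * v i| ≤ C * U * V ∧
      |z - y| ^ 2 * |∑ i ∈ Finset.range n, ((n : ℝ) - i) * u i * v i| ≤ C * U * V := by
  obtain ⟨C₁, hC₁⟩ := exists_dirichlet_bound_int (diagInt_neg hA) (L := L)
    (summable_abs_diagInt_sub hA hBV)
  obtain ⟨C₂, hC₂⟩ := exists_fejer_bound_int (diagInt_neg hA) (L := L)
    (summable_abs_diagInt_sub hA hBV)
  refine ⟨max C₁ C₂, fun n u v z y U V hu hv hU hV => ?_⟩
  have hU0 : 0 ≤ U := (abs_nonneg _).trans (hU 0)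
  have hV0 : 0 ≤ V := (abs_nonneg _).trans (hV 0)
  have hv0 : ∀ k < 0, extendInt v k = 0 := fun k hk => if_neg (by omega)
  have h1 := hC₁ n _ _ z y U V hv0 (extendInt_recurrence hband hu) (extendInt_recurrence hband hv)
    (abs_extendInt_le hU) (abs_extendInt_le hV)
  have h2 := hC₂ n _ _ z y U V hv0 (extendInt_recurrence hband hu) (extendInt_recurrence hband hv)
    (abs_extendInt_le hU) (abs_extendInt_le hV)
  rw [tsum_mul_extendInt _ n (fun k hk => if_neg (by omega)), abs_mul] at h1
  rw [tsum_mul_extendInt _ n (fun k hk => by rw [max_eq_right (by omega), Int.cast_zero]),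
    abs_mul, abs_pow] at h2
  have s1 : ∑ i ∈ Finset.range n, (if (i : ℤ) < n then 1 else 0) * u i * v i =
      ∑ i ∈ Finset.range n, u i * v i := Finset.sum_congr rfl fun i hi => by
    rw [if_pos (by exact_mod_cast Finset.mem_range.mp hi), one_mul]
  have s2 : ∑ i ∈ Finset.range n, ((max ((n : ℤ) - i) 0 : ℤ) : ℝ) * u i * v i =
      ∑ i ∈ Finset.range n, ((n : ℝ) - i) * u i * v i := Finset.sum_congr rfl fun i hi => by
    have := Finset.mem_range.mp hi
    rw [max_eq_left (by omega)]; push_cast; ring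
  rw [s1] at h1
  rw [s2] at h2
  have hm : ∀ c, c ≤ max C₁ C₂ → c * U * V ≤ max C₁ C₂ * U * V := fun c hc =>
    mul_le_mul_of_nonneg_right (mul_le_mul_of_nonneg_right hc hU0) hV0
  exact ⟨h1.trans (hm _ (le_max_left _ _)), h2.trans (hm _ (le_max_right _ _))⟩

/-! ### Summation by parts with a quasiconvex multiplier. -/

/-- As Δφ → 0, Δφ_n is the tail sum of the second differences, and n ≤ k + 1 on that tail; so
n|Δφ_n| is at most a tail of the convergent series. -/
theorem tendsto_nat_mul_sub_succ_of_summable {φ : ℕ → ℝ}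
    (hs : Summable fun k : ℕ => ((k : ℝ) + 1) * |φ k - 2 * φ (k + 1) + φ (k + 2)|)
    (h0 : Tendsto φ atTop (𝓝 0)) :
    Tendsto (fun n : ℕ => (n : ℝ) * |φ n - φ (n + 1)|) atTop (𝓝 0) := by
  set g : ℕ → ℝ := fun k => ((k : ℝ) + 1) * |φ k - 2 * φ (k + 1) + φ (k + 2)| with hg
  have hg0 : ∀ k, 0 ≤ g k := fun k => by positivity
  have hΔ : Tendsto (fun n => φ n - φ (n + 1)) atTop (𝓝 0) := by
    simpa using h0.sub ((tendsto_add_atTop_iff_nat 1).mpr h0)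
  have hstep : ∀ n m : ℕ, (n : ℝ) * |φ n - φ (n + 1)| ≤
      n * |φ (n + m) - φ (n + m + 1)| + ∑ k ∈ Finset.range m, g (k + n) := by
    intro n m
    induction m with
    | zero => simp
    | succ m ih =>
      refine ih.trans ?_
      rw [Finset.sum_range_succ]
      have h1 : |φ (n + m) - φ (n + m + 1)| ≤ |φ (n + (m + 1)) - φ (n + (m + 1) + 1)| +
          |φ (m + n) - 2 * φ (m + n + 1) + φ (m + n + 2)| := by
        rw [show m + n = n + m by ring]
        have := abs_add_le (φ (n + (m + 1)) - φ (n + (m + 1) + 1))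
          (φ (n + m) - 2 * φ (n + m + 1) + φ (n + m + 2))
        refine le_trans (le_of_eq ?_) this
        congr 1
        rw [show n + (m + 1) = n + m + 1 by ring, show n + m + 1 + 1 = n + m + 2 by ring]
        ring
      have h2 : (n : ℝ) * |φ (m + n) - 2 * φ (m + n + 1) + φ (m + n + 2)| ≤ g (m + n) := by
        simp only [hg]
        refine mul_le_mul_of_nonneg_right ?_ (abs_nonneg _)
        push_cast
        have : (0 : ℝ) ≤ m := Nat.cast_nonneg m
        linarith
      have h3 := mul_le_mul_of_nonneg_left h1 (Nat.cast_nonneg (α := ℝ) n)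
      linarith
  have hle : ∀ n : ℕ, (n : ℝ) * |φ n - φ (n + 1)| ≤ ∑' k, g (k + n) := by
    intro n
    have hsn : Summable fun k => g (k + n) := (summable_nat_add_iff n).mpr hs
    have hlim : Tendsto (fun m => (n : ℝ) * |φ (n + m) - φ (n + m + 1)| + ∑' k, g (k + n)) atTop
        (𝓝 (n * |0| + ∑' k, g (k + n))) := by
      refine ((Tendsto.abs ?_).const_mul _).add_const _
      refine hΔ.comp (tendsto_atTop_mono (fun m => ?_) tendsto_id)
      exact Nat.le_add_left m n
    rw [abs_zero, mul_zero, zero_add] at hlim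
    refine ge_of_tendsto' hlim fun m => (hstep n m).trans ?_
    gcongr
    exact hsn.sum_le_tsum _ fun _ _ => hg0 _
  exact squeeze_zero (fun n => by positivity) hle (tendsto_sum_nat_add g)

/-- Abel summation applied twice; the weights n - i produce the sum of the first n partial sums. -/
theorem sum_range_mul_eq_second_difference (φ a : ℕ → ℝ) (n : ℕ) :
    ∑ k ∈ Finset.range n, φ k * a k =
      φ n * ∑ i ∈ Finset.range n, a i +
      (φ n - φ (n + 1)) * ∑ i ∈ Finset.range n, ((n : ℝ) - i) * a i +
      ∑ k ∈ Finset.range n, (φ k - 2 * φ (k + 1) + φ (k + 2)) *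
        ∑ i ∈ Finset.range (k + 1), (((k + 1 : ℕ) : ℝ) - i) * a i := by
  induction n with
  | zero => simp
  | succ n ih =>
    have e : ∑ i ∈ Finset.range (n + 1), (((n + 1 : ℕ) : ℝ) - i) * a i =
        ∑ i ∈ Finset.range n, ((n : ℝ) - i) * a i + ∑ i ∈ Finset.range (n + 1), a i := by
      rw [Finset.sum_range_succ, Finset.sum_range_succ a, ← add_assoc, ← Finset.sum_add_distrib]
      congr 1
      · exact Finset.sum_congr rfl fun i _ => by push_cast; ring
      · push_cast; ring
    rw [Finset.sum_range_succ, ih,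
      Finset.sum_range_succ (fun k => (φ k - 2 * φ (k + 1) + φ (k + 2)) *
        ∑ i ∈ Finset.range (k + 1), (((k + 1 : ℕ) : ℝ) - i) * a i), e, Finset.sum_range_succ a]
    ring

/-- A quasiconvex multiplier that decays like `1 / log` turns Cesàro boundedness and
logarithmic control of partial sums into uniform convergence. -/
theorem exists_tendstoUniformlyOn_of_quasiconvex {φ : ℕ → ℝ} (hφ : IsQuasiconvex φ)
    (hlog : φ =O[atTop] fun k : ℕ => 1 / Real.log (k : ℝ)) {K : Set ℝ} {a : ℕ → ℝ → ℝ} {C : ℝ}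
    (hC : ∀ n : ℕ, ∀ x ∈ K, |∑ i ∈ Finset.range n, ((n : ℝ) - i) * a i x| ≤ C * n)
    (ho : ∀ ε > 0, ∀ᶠ n : ℕ in atTop, ∀ x ∈ K,
      |∑ i ∈ Finset.range n, a i x| ≤ ε * Real.log n) :
    ∃ T : ℝ → ℝ, TendstoUniformlyOn (fun n x => ∑ k ∈ Finset.range n, φ k * a k x) T atTop K := by
  have hlogt : Tendsto (fun n : ℕ => Real.log (n : ℝ)) atTop atTop :=
    Real.tendsto_log_atTop.comp tendsto_natCast_atTop_atTop
  have h0 : Tendsto φ atTop (𝓝 0) := by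
    refine hlog.trans_tendsto ?_
    simp only [one_div]
    exact hlogt.inv_tendsto_atTop
  have hΔ := tendsto_nat_mul_sub_succ_of_summable hφ.2 h0
  -- The two boundary terms tend to 0, so the limit is the second-difference series, dominated by
  -- C(k+1)|Δ²φ_k|.
  set T : ℝ → ℝ := fun x => ∑' k, (φ k - 2 * φ (k + 1) + φ (k + 2)) *
        ∑ i ∈ Finset.range (k + 1), (((k + 1 : ℕ) : ℝ) - i) * a i x with hT
  have hunif := tendstoUniformlyOn_tsum_nat (f := fun k x => (φ k - 2 * φ (k + 1) + φ (k + 2)) *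
        ∑ i ∈ Finset.range (k + 1), (((k + 1 : ℕ) : ℝ) - i) * a i x) (s := K)
    (hφ.2.mul_left C) (fun k x hx => by
      rw [Real.norm_eq_abs, abs_mul]
      have := mul_le_mul_of_nonneg_left (hC (k + 1) x hx)
        (abs_nonneg (φ k - 2 * φ (k + 1) + φ (k + 2)))
      push_cast at this ⊢
      linarith)
  refine ⟨T, ?_⟩
  rw [Metric.tendstoUniformlyOn_iff] at hunif ⊢
  intro ε hε
  obtain ⟨B, hB0, hB⟩ := hlog.exists_pos
  have hB' := hB.bound
  have hCC : ∀ᶠ n : ℕ in atTop, C * ((n : ℝ) * |φ n - φ (n + 1)|) < ε / 3 := by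
    have := hΔ.const_mul C
    rw [mul_zero] at this
    exact this.eventually (gt_mem_nhds (by positivity))
  filter_upwards [hunif (ε / 3) (by positivity), hB', ho (ε / 3 / B / 2) (by positivity), hCC,
    hlogt.eventually_gt_atTop 0] with n h1 h2 h3 h4 h5 x hx
  have h1x := h1 x hx
  rw [Real.dist_eq, abs_sub_comm] at h1x ⊢
  rw [sum_range_mul_eq_second_difference φ (fun k => a k x) n]
  have e1 : |φ n * ∑ i ∈ Finset.range n, a i x| < ε / 3 := by
    rw [abs_mul]
    rw [Real.norm_eq_abs, Real.norm_eq_abs, abs_of_pos (one_div_pos.mpr h5)] at h2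
    calc _ ≤ (B * (1 / Real.log n)) * (ε / 3 / B / 2 * Real.log n) :=
          mul_le_mul h2 (h3 x hx) (abs_nonneg _) (by positivity)
      _ = ε / 3 / 2 := by field_simp
      _ < ε / 3 := by linarith
  have e2 : |(φ n - φ (n + 1)) * ∑ i ∈ Finset.range n, ((n : ℝ) - i) * a i x| < ε / 3 := by
    rw [abs_mul]
    refine lt_of_le_of_lt (mul_le_mul_of_nonneg_left (hC n x hx) (abs_nonneg _)) ?_
    linarith
  rw [add_sub_assoc]
  refine (abs_add_le _ _).trans_lt ?_
  have := abs_add_le (φ n * ∑ i ∈ Finset.range n, a i x)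
    ((φ n - φ (n + 1)) * ∑ i ∈ Finset.range n, ((n : ℝ) - i) * a i x)
  linarith

/-! ### Staircase majorants of the kernels. -/

/-- `m` is the first index with y > 1/(m+1), capped at `n`: an integer substitute for min(n, 1/y).
-/
theorem exists_index_le_one_div (n : ℕ) (y : ℝ) :
    ∃ m ≤ n, (∀ k < m, y ≤ 1 / ((k : ℝ) + 1)) ∧ (m = n ∨ 1 ≤ ((m : ℝ) + 1) * y) := by
  induction n with
  | zero => exact ⟨0, le_rfl, by simp, Or.inl rfl⟩
  | succ n ih =>
    obtain ⟨m, hm, h1, h2⟩ := ih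
    rcases h2 with rfl | h2
    · by_cases hy : y ≤ 1 / ((m : ℝ) + 1)
      · refine ⟨m + 1, le_rfl, fun k hk => ?_, Or.inl rfl⟩
        rcases Nat.lt_succ_iff_lt_or_eq.mp hk with hk | rfl
        · exact h1 k hk
        · exact hy
      · refine ⟨m, by omega, h1, Or.inr ?_⟩
        rw [not_le, div_lt_iff₀ (by positivity)] at hy
        linarith
    · exact ⟨m, by omega, h1, Or.inr h2⟩

theorem sum_range_le_sum_ite {w : ℕ → ℝ} (hw : ∀ k, 0 ≤ w k) {m n : ℕ} (hmn : m ≤ n) {y : ℝ}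
    (hm : ∀ k < m, y ≤ 1 / ((k : ℝ) + 1)) :
    ∑ k ∈ Finset.range m, w k ≤
      ∑ k ∈ Finset.range n, if y ≤ 1 / ((k : ℝ) + 1) then w k else 0 := by
  calc ∑ k ∈ Finset.range m, w k
      = ∑ k ∈ Finset.range m, if y ≤ 1 / ((k : ℝ) + 1) then w k else 0 :=
        Finset.sum_congr rfl fun k hk => by rw [if_pos (hm k (Finset.mem_range.mp hk))]
    _ ≤ _ := Finset.sum_le_sum_of_subset_of_nonneg (Finset.range_subset_range.mpr hmn)
        fun k _ _ => by split_ifs; exacts [hw k, le_rfl]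

/-- Turns min(n, 1/y) into a sum of indicators of y ≤ 1/(k+1). With y = |t - x|, integration then
yields integrals over shrinking intervals about x, which the Lebesgue point condition controls. -/
theorem le_mul_one_add_sum_ite {n : ℕ} {y D C H : ℝ} (hC : 1 ≤ C) (hH : 0 ≤ H) (hD : 0 ≤ D)
    (h1 : D ≤ n * H) (h2 : y * D ≤ C * H) :
    D ≤ C * H * (1 + ∑ k ∈ Finset.range n, if y ≤ 1 / ((k : ℝ) + 1) then 1 else 0) := by
  obtain ⟨m, hmn, hm, hor⟩ := exists_index_le_one_div n y
  have hle := sum_range_le_sum_ite (w := fun _ => 1) (fun _ => zero_le_one) hmn hm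
  rw [Finset.sum_const, Finset.card_range, nsmul_eq_mul, mul_one] at hle
  have hCH : 0 ≤ C * H := by positivity
  refine le_trans ?_ (mul_le_mul_of_nonneg_left (add_le_add_right hle 1) hCH)
  rcases hor with rfl | hor
  · have : (m : ℝ) * H ≤ (1 + m) * (C * H) := by
      have h3 : H ≤ C * H := le_mul_of_one_le_left hH hC
      have h4 : (m : ℝ) * H ≤ m * (C * H) := mul_le_mul_of_nonneg_left h3 (Nat.cast_nonneg m)
      linarith
    linarith
  · have h3 := mul_le_mul_of_nonneg_right hor hD
    have h4 := mul_le_mul_of_nonneg_left h2 (show (0 : ℝ) ≤ m + 1 by positivity)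
    linarith

/-- The weights 2k + 3 = (k+2)² - (k+1)² telescope, so the staircase reproduces min(n², 1/y²). -/
theorem le_mul_one_add_sum_ite_sq {n : ℕ} {y D C H : ℝ} (hC : 1 ≤ C) (hH : 0 ≤ H) (hD : 0 ≤ D)
    (h1 : D ≤ (n : ℝ) ^ 2 * H) (h2 : y ^ 2 * D ≤ C * H) :
    D ≤ C * H * (1 + ∑ k ∈ Finset.range n,
      if y ≤ 1 / ((k : ℝ) + 1) then 2 * (k : ℝ) + 3 else 0) := by
  obtain ⟨m, hmn, hm, hor⟩ := exists_index_le_one_div n y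
  have hsum : ∀ m : ℕ, ∑ k ∈ Finset.range m, (2 * (k : ℝ) + 3) = (m + 1 : ℝ) ^ 2 - 1 := by
    intro m
    induction m with
    | zero => simp
    | succ m ih => rw [Finset.sum_range_succ, ih]; push_cast; ring
  have hle := sum_range_le_sum_ite (w := fun k => 2 * (k : ℝ) + 3) (fun _ => by positivity) hmn hm
  rw [hsum] at hle
  have hCH : 0 ≤ C * H := by positivity
  refine le_trans ?_ (mul_le_mul_of_nonneg_left (add_le_add_right hle 1) hCH)
  rw [add_sub_cancel]
  rcases hor with rfl | hor
  · have h3 : H ≤ C * H := le_mul_of_one_le_left hH hC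
    have h4 : (m : ℝ) ^ 2 * H ≤ (m + 1 : ℝ) ^ 2 * (C * H) :=
      mul_le_mul (by gcongr; linarith) h3 hH (by positivity)
    linarith
  · have h3 : (1 : ℝ) ≤ ((m + 1) * y) ^ 2 := one_le_pow₀ hor
    have h5 := mul_le_mul_of_nonneg_right h3 hD
    have h4 := mul_le_mul_of_nonneg_left h2 (show (0 : ℝ) ≤ (m + 1) ^ 2 by positivity)
    linarith

/-! ### Algebra of the Sobolev product and multiplication by π_{N+1}. -/

open Polynomial in
theorem Polynomial.exists_derivative_eq (P : ℝ[X]) : ∃ R : ℝ[X], derivative R = P := by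
  induction P using Polynomial.induction_on' with
  | add p q hp hq =>
    obtain ⟨r, rfl⟩ := hp
    obtain ⟨s, rfl⟩ := hq
    exact ⟨r + s, derivative_add⟩
  | monomial n a =>
    refine ⟨monomial (n + 1) (a / (n + 1)), ?_⟩
    rw [derivative_monomial_succ, div_mul_cancel₀]
    positivity

theorem derivI_polynomial_eval (P : Polynomial ℝ) (i : ℕ) {x : ℝ} (hx : x ∈ Icc (-1 : ℝ) 1) :
    derivI i (fun t => P.eval t) x = (Polynomial.derivative^[i] P).eval x := by
  unfold derivI
  induction i generalizing x with
  | zero => simp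
  | succ i ih =>
    rw [iteratedDerivWithin_succ, derivWithin_congr (fun y hy => ih hy) (ih hx),
      Function.iterate_succ_apply', Polynomial.derivWithin]
    exact uniqueDiffOn_Icc (by norm_num) x hx

namespace SobolevData

variable (S : SobolevData)

instance : IsFiniteMeasure S.θ := S.finite

theorem ord_lt_ordStar (k : Fin S.m) : S.ord k < S.ordStar k := by
  unfold ordStar; split_ifs <;> omega

theorem even_ordStar (k : Fin S.m) : Even (S.ordStar k) := by
  unfold ordStar
  split_ifs with h
  · exact h.add_one
  · exact (Nat.not_odd_iff_even.mp h).add (by decide)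

theorem w_nonneg (x : ℝ) : 0 ≤ S.w x :=
  Finset.prod_nonneg fun k _ => (S.even_ordStar k).pow_nonneg _

theorem w_pos {x : ℝ} (hx : x ∈ S.eps) : 0 < S.w x := by
  refine Finset.prod_pos fun k _ => (S.even_ordStar k).pow_pos ?_
  exact sub_ne_zero.mpr fun h => hx.2 ⟨k, h.symm⟩

theorem continuous_w : Continuous S.w := by
  unfold w; fun_prop

theorem M_nonneg' {k : Fin S.m} {i : ℕ} (hi : i ≤ S.ord k) : 0 ≤ S.M k i := by
  rcases hi.lt_or_eq with hi | rfl
  · exact S.M_nonneg k i hi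
  · exact (S.M_pos k).le

open Polynomial in
theorem exists_primitive_polynomial : ∃ R : ℝ[X], (∀ x, R.eval x = S.primW x) ∧
    R.natDegree = S.N + 1 ∧ ∀ k, ∀ i ≤ S.ord k, ∀ P : ℝ[X],
      (derivative^[i] (R * P)).eval (S.a k) =
        S.primW (S.a k) * (derivative^[i] P).eval (S.a k) := by
  set W : ℝ[X] := ∏ k, (X - C (S.a k)) ^ S.ordStar k with hW
  have hWeval : ∀ x, W.eval x = S.w x := fun x => by
    simp [hW, eval_prod, w]
  have hWmonic : W.Monic := monic_prod_of_monic _ _ fun k _ => (monic_X_sub_C _).pow _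
  have hWdeg : W.natDegree = S.N := by
    rw [hW, natDegree_prod_of_monic _ _ fun k _ => (monic_X_sub_C _).pow _]
    simp [N]
  obtain ⟨R₀, hR₀⟩ := W.exists_derivative_eq
  -- The constant makes the primitive vanish at -1, the base point of `primW`.
  set R : ℝ[X] := R₀ - C (R₀.eval (-1)) with hR
  have hRW : derivative R = W := by rw [hR, derivative_sub, derivative_C, sub_zero, hR₀]
  have heval : ∀ x, R.eval x = S.primW x := fun x => by
    unfold primW
    rw [intervalIntegral.integral_eq_sub_of_hasDerivAt (f := fun t => R.eval t)]
    · simp [hR]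
    · intro t _
      rw [← hWeval, ← hRW]
      exact R.hasDerivAt t
    · exact S.continuous_w.intervalIntegrable _ _
  refine ⟨R, heval, ?_, fun k i hi P => ?_⟩
  · have h1 := natDegree_derivative R
    rw [hRW, hWdeg] at h1
    have h2 : R.natDegree ≠ 0 := fun h => by
      have := derivative_of_natDegree_zero h
      rw [hRW] at this
      exact hWmonic.ne_zero this
    omega
  -- In the Leibniz sum every term that differentiates `R` vanishes at a_k: `R` has derivative `W`,
  -- divisible by a power of X - a_k exceeding N_k.
  · rw [iterate_derivative_mul, eval_finsetSum, Finset.sum_range_succ, Finset.sum_eq_zero]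
    · simp [heval]
    · intro j hj
      rw [Finset.mem_range] at hj
      obtain ⟨r, hr⟩ : ∃ r, i - j = r + 1 := ⟨i - j - 1, by omega⟩
      have hdvd : (X - C (S.a k)) ^ S.ordStar k ∣ W := Finset.dvd_prod_of_mem _ (Finset.mem_univ k)
      have h0 : (derivative^[i - j] R).eval (S.a k) = 0 := by
        rw [hr, Function.iterate_succ_apply, hRW]
        have h1 := pow_sub_dvd_iterate_derivative_of_pow_dvd r hdvd
        have h2 : S.ordStar k - r ≠ 0 := by
          have := S.ord_lt_ordStar k
          omega
        exact dvd_iff_isRoot.mp ((dvd_pow_self _ h2).trans h1)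
      simp [h0]

/-- The polynomial whose values are `π_{N+1}`. -/
noncomputable def primPoly : Polynomial ℝ := S.exists_primitive_polynomial.choose

theorem primPoly_eval (x : ℝ) : S.primPoly.eval x = S.primW x :=
  S.exists_primitive_polynomial.choose_spec.1 x

theorem natDegree_primPoly : S.primPoly.natDegree = S.N + 1 :=
  S.exists_primitive_polynomial.choose_spec.2.1

theorem iterate_derivative_primPoly_mul {k : Fin S.m} {i : ℕ} (hi : i ≤ S.ord k)
    (P : Polynomial ℝ) :
    (Polynomial.derivative^[i] (S.primPoly * P)).eval (S.a k) =
      S.primW (S.a k) * (Polynomial.derivative^[i] P).eval (S.a k) :=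
  S.exists_primitive_polynomial.choose_spec.2.2 k i hi P

theorem ae_mem_Icc : ∀ᵐ x ∂S.θ, x ∈ Icc (-1 : ℝ) 1 := by
  rw [ae_iff]; exact S.carried

theorem integrable_mul_polynomial {g : ℝ → ℝ} (hg : Integrable g S.θ) (P : Polynomial ℝ) :
    Integrable (fun x => g x * P.eval x) S.θ := by
  obtain ⟨B, hB⟩ := isCompact_Icc.exists_bound_of_continuousOn (s := Icc (-1 : ℝ) 1)
    P.continuous.continuousOn
  exact hg.mul_bdd P.continuous.aestronglyMeasurable (S.ae_mem_Icc.mono hB)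

theorem integrable_polynomial (P : Polynomial ℝ) : Integrable (fun x => P.eval x) S.θ := by
  simpa using S.integrable_mul_polynomial (integrable_const (1 : ℝ)) P

/-- The linear functional on polynomials with integral density `g` and discrete weights `F`. -/
noncomputable def pairing (g : ℝ → ℝ) (F : Fin S.m → ℕ → ℝ) (P : Polynomial ℝ) : ℝ :=
  (∫ x, g x * P.eval x ∂S.θ) + ∑ k : Fin S.m, ∑ i ∈ Finset.range (S.ord k + 1),
    S.M k i * F k i * (Polynomial.derivative^[i] P).eval (S.a k)

theorem ip_eq_pairing (f : ℝ → ℝ) (P : Polynomial ℝ) :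
    S.ip f (fun x => P.eval x) = S.pairing f (fun k i => derivI i f (S.a k)) P := by
  unfold ip pairing
  congr 1
  refine Finset.sum_congr rfl fun k _ => Finset.sum_congr rfl fun i _ => ?_
  rw [derivI_polynomial_eval P i (S.a_mem k)]

theorem pairing_sum {g : ℝ → ℝ} (hg : Integrable g S.θ) (F : Fin S.m → ℕ → ℝ) (s : Finset ℕ)
    (c : ℕ → ℝ) (P : ℕ → Polynomial ℝ) :
    S.pairing g F (∑ j ∈ s, c j • P j) = ∑ j ∈ s, c j * S.pairing g F (P j) := by
  have h1 : ∫ x, g x * (∑ j ∈ s, c j • P j).eval x ∂S.θ =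
      ∑ j ∈ s, c j * ∫ x, g x * (P j).eval x ∂S.θ := by
    simp only [← integral_const_mul]
    rw [← integral_finsetSum _ fun j _ => (S.integrable_mul_polynomial hg (P j)).const_mul (c j)]
    refine integral_congr_ae (ae_of_all _ fun x => ?_)
    simp only [Polynomial.eval_finsetSum, Polynomial.eval_smul, smul_eq_mul, Finset.mul_sum]
    exact Finset.sum_congr rfl fun j _ => by ring
  unfold pairing
  simp only [mul_add, Finset.sum_add_distrib, h1]
  congr 1
  simp only [Polynomial.iterate_derivative_sum, Polynomial.eval_finsetSum,
    Polynomial.iterate_derivative_smul, Polynomial.eval_smul, smul_eq_mul, Finset.mul_sum]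
  rw [Finset.sum_comm' (s := s) (t := fun _ => Finset.univ) (t' := Finset.univ) (s' := fun _ => s)
    (by simp)]
  refine Finset.sum_congr rfl fun k _ => ?_
  rw [Finset.sum_comm]
  exact Finset.sum_congr rfl fun j _ => Finset.sum_congr rfl fun i _ => by ring

theorem ip_comm (f g : ℝ → ℝ) : S.ip f g = S.ip g f := by
  unfold ip
  congr 1
  · exact integral_congr_ae (ae_of_all _ fun x => mul_comm _ _)
  · exact Finset.sum_congr rfl fun k _ => Finset.sum_congr rfl fun i _ => by ring

/-- The inner product of two polynomials. -/
noncomputable def ipPoly (P Q : Polynomial ℝ) : ℝ :=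
  S.ip (fun x => P.eval x) (fun x => Q.eval x)

theorem ipPoly_comm (P Q : Polynomial ℝ) : S.ipPoly P Q = S.ipPoly Q P := S.ip_comm _ _

theorem ipPoly_eq (P Q : Polynomial ℝ) : S.ipPoly P Q =
    (∫ x, P.eval x * Q.eval x ∂S.θ) + ∑ k : Fin S.m, ∑ i ∈ Finset.range (S.ord k + 1),
      S.M k i * (Polynomial.derivative^[i] P).eval (S.a k) *
        (Polynomial.derivative^[i] Q).eval (S.a k) := by
  unfold ipPoly ip
  congr 1
  refine Finset.sum_congr rfl fun k _ => Finset.sum_congr rfl fun i _ => ?_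
  rw [derivI_polynomial_eval P i (S.a_mem k), derivI_polynomial_eval Q i (S.a_mem k)]

theorem ipPoly_sum_right (P : Polynomial ℝ) (s : Finset ℕ) (c : ℕ → ℝ) (Q : ℕ → Polynomial ℝ) :
    S.ipPoly P (∑ j ∈ s, c j • Q j) = ∑ j ∈ s, c j * S.ipPoly P (Q j) := by
  simp only [ipPoly, ip_eq_pairing]
  exact S.pairing_sum (S.integrable_polynomial P) _ s c Q

theorem ipPoly_primPoly_mul (P Q : Polynomial ℝ) :
    S.ipPoly (S.primPoly * P) Q = S.ipPoly P (S.primPoly * Q) := by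
  rw [ipPoly_eq, ipPoly_eq]
  congr 1
  · refine integral_congr_ae (ae_of_all _ fun x => ?_)
    simp only [Polynomial.eval_mul]; ring
  · refine Finset.sum_congr rfl fun k _ => Finset.sum_congr rfl fun i hi => ?_
    have hi' : i ≤ S.ord k := Nat.lt_succ_iff.mp (Finset.mem_range.mp hi)
    rw [S.iterate_derivative_primPoly_mul hi', S.iterate_derivative_primPoly_mul hi']
    ring

variable {S} {q : ℕ → Polynomial ℝ}

namespace IsOrthonormalSystem

theorem ipPoly_eq_ite (hq : S.IsOrthonormalSystem q) (n k : ℕ) :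
    S.ipPoly (q n) (q k) = if n = k then 1 else 0 := hq.2 n k

theorem exists_eq_sum (hq : S.IsOrthonormalSystem q) (n : ℕ) (P : Polynomial ℝ)
    (hP : ∀ m, n ≤ m → P.coeff m = 0) :
    ∃ c : ℕ → ℝ, P = ∑ j ∈ Finset.range n, c j • q j := by
  induction n generalizing P with
  | zero =>
    refine ⟨0, ?_⟩
    ext m
    simp [hP m (Nat.zero_le m)]
  | succ n ih =>
    have hlc : (q n).coeff n ≠ 0 := by
      have := (hq.1 n).2
      rw [Polynomial.leadingCoeff, (hq.1 n).1] at this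
      exact this.ne'
    obtain ⟨c, hc⟩ := ih (P - (P.coeff n / (q n).coeff n) • q n) fun m hm => by
      rw [Polynomial.coeff_sub, Polynomial.coeff_smul, smul_eq_mul]
      rcases hm.eq_or_lt with rfl | hm
      · rw [div_mul_cancel₀ _ hlc, sub_self]
      · rw [hP m hm, Polynomial.coeff_eq_zero_of_natDegree_lt (p := q n) (n := m) (by rw [(hq.1 n).1]; exact hm)]
        simp
    refine ⟨fun j => if j = n then P.coeff n / (q n).coeff n else c j, ?_⟩
    simp only
    rw [Finset.sum_range_succ, if_pos rfl, ← sub_eq_iff_eq_add, hc]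
    refine Finset.sum_congr rfl fun j hj => ?_
    rw [if_neg (Finset.mem_range.mp hj).ne]

theorem eq_sum_ipPoly (hq : S.IsOrthonormalSystem q) (n : ℕ) (P : Polynomial ℝ)
    (hP : ∀ m, n ≤ m → P.coeff m = 0) :
    P = ∑ j ∈ Finset.range n, S.ipPoly P (q j) • q j := by
  obtain ⟨c, hc⟩ := hq.exists_eq_sum n P hP
  conv_lhs => rw [hc]
  refine Finset.sum_congr rfl fun j hj => ?_
  rw [S.ipPoly_comm, hc, S.ipPoly_sum_right]
  simp only [hq.ipPoly_eq_ite, mul_ite, mul_one, mul_zero]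
  rw [Finset.sum_ite_eq, if_pos hj]

theorem ipPoly_eq_zero (hq : S.IsOrthonormalSystem q) (n : ℕ) (P : Polynomial ℝ)
    (hP : ∀ m, n ≤ m → P.coeff m = 0) : S.ipPoly P (q n) = 0 := by
  rw [hq.eq_sum_ipPoly n P hP, S.ipPoly_comm, S.ipPoly_sum_right]
  refine Finset.sum_eq_zero fun j hj => ?_
  rw [hq.ipPoly_eq_ite, if_neg (Finset.mem_range.mp hj).ne', mul_zero]

end IsOrthonormalSystem

variable (S q) in
/-- The matrix of multiplication by `π_{N+1}` in the basis `q`. -/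
noncomputable def mulMatrix (n m : ℕ) : ℝ := S.ipPoly (S.primPoly * q n) (q m)

theorem mulMatrix_comm (n m : ℕ) : S.mulMatrix q n m = S.mulMatrix q m n := by
  unfold mulMatrix
  rw [ipPoly_primPoly_mul, ipPoly_comm]

theorem recCoeff_eq_mulMatrix (s l : ℕ) : S.recCoeff q (s + l) l = S.mulMatrix q (s + l) s := by
  unfold recCoeff mulMatrix ipPoly
  rw [if_pos (by omega), show s + l - l = s by omega]
  simp only [Polynomial.eval_mul, primPoly_eval]

namespace IsOrthonormalSystem

theorem coeff_primPoly_mul (hq : S.IsOrthonormalSystem q) (n m : ℕ) (h : n + (S.N + 1) + 1 ≤ m) :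
    (S.primPoly * q n).coeff m = 0 := by
  refine Polynomial.coeff_eq_zero_of_natDegree_lt (Polynomial.natDegree_mul_le.trans_lt ?_)
  rw [natDegree_primPoly, (hq.1 n).1]
  omega

theorem mulMatrix_eq_zero (hq : S.IsOrthonormalSystem q) (n m : ℕ) (h : m + (S.N + 1) < n) :
    S.mulMatrix q n m = 0 := by
  rw [mulMatrix_comm]
  exact hq.ipPoly_eq_zero n _ fun j hj => hq.coeff_primPoly_mul m j (by omega)

theorem primPoly_mul_eq (hq : S.IsOrthonormalSystem q) (n : ℕ) :
    S.primPoly * q n = ∑ m ∈ Finset.range (n + (S.N + 1) + 1), S.mulMatrix q n m • q m :=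
  hq.eq_sum_ipPoly _ _ fun m hm => hq.coeff_primPoly_mul n m hm

theorem recurrence_eval (hq : S.IsOrthonormalSystem q) (t : ℝ) (n : ℕ) :
    S.primW t * (q n).eval t =
      ∑ m ∈ Finset.range (n + (S.N + 1) + 1), S.mulMatrix q n m * (q m).eval t := by
  rw [← primPoly_eval, ← Polynomial.eval_mul, hq.primPoly_mul_eq, Polynomial.eval_finsetSum]
  simp only [Polynomial.eval_smul, smul_eq_mul]

/-- Makes the kernel bounds applicable to the discrete part, with spectral value π(a_k). -/
theorem recurrence_derivative (hq : S.IsOrthonormalSystem q) {k : Fin S.m} {i : ℕ}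
    (hi : i ≤ S.ord k) (n : ℕ) :
    S.primW (S.a k) * (Polynomial.derivative^[i] (q n)).eval (S.a k) =
      ∑ m ∈ Finset.range (n + (S.N + 1) + 1),
        S.mulMatrix q n m * (Polynomial.derivative^[i] (q m)).eval (S.a k) := by
  rw [← S.iterate_derivative_primPoly_mul hi, hq.primPoly_mul_eq,
    Polynomial.iterate_derivative_sum, Polynomial.eval_finsetSum]
  simp only [Polynomial.iterate_derivative_smul, Polynomial.eval_smul, smul_eq_mul]

theorem norm_eq_one (hq : S.IsOrthonormalSystem q) (n : ℕ) :
    (∫ x, (q n).eval x ^ 2 ∂S.θ) + ∑ k : Fin S.m, ∑ i ∈ Finset.range (S.ord k + 1),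
      S.M k i * (Polynomial.derivative^[i] (q n)).eval (S.a k) ^ 2 = 1 := by
  have := hq.ipPoly_eq_ite n n
  rw [ipPoly_eq, if_pos rfl] at this
  rw [← this]
  congr 1
  · exact integral_congr_ae (ae_of_all _ fun x => pow_two _)
  · exact Finset.sum_congr rfl fun k _ => Finset.sum_congr rfl fun i _ => by ring

theorem integral_sq_le_one (hq : S.IsOrthonormalSystem q) (n : ℕ) :
    ∫ x, (q n).eval x ^ 2 ∂S.θ ≤ 1 := by
  rw [← hq.norm_eq_one n]
  refine le_add_of_nonneg_right (Finset.sum_nonneg fun k _ => Finset.sum_nonneg fun i hi => ?_)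
  exact mul_nonneg (S.M_nonneg' (Nat.lt_succ_iff.mp (Finset.mem_range.mp hi))) (sq_nonneg _)

theorem weight_mul_sq_le_one (hq : S.IsOrthonormalSystem q) (n : ℕ) {k : Fin S.m} {i : ℕ}
    (hi : i ≤ S.ord k) :
    S.M k i * (Polynomial.derivative^[i] (q n)).eval (S.a k) ^ 2 ≤ 1 := by
  rw [← hq.norm_eq_one n]
  have h0 : ∀ k : Fin S.m, ∀ i ∈ Finset.range (S.ord k + 1),
      0 ≤ S.M k i * (Polynomial.derivative^[i] (q n)).eval (S.a k) ^ 2 := fun k i hi =>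
    mul_nonneg (S.M_nonneg' (Nat.lt_succ_iff.mp (Finset.mem_range.mp hi))) (sq_nonneg _)
  refine le_add_of_nonneg_of_le (integral_nonneg fun x => sq_nonneg _) ?_
  refine le_trans ?_ (Finset.single_le_sum (f := fun k => ∑ i ∈ Finset.range (S.ord k + 1),
      S.M k i * (Polynomial.derivative^[i] (q n)).eval (S.a k) ^ 2)
      (fun k _ => Finset.sum_nonneg (h0 k)) (Finset.mem_univ k))
  exact Finset.single_le_sum (h0 k) (Finset.mem_range.mpr (by omega))

theorem exists_abs_derivative_le (hq : S.IsOrthonormalSystem q) {k : Fin S.m} {i : ℕ}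
    (hM : 0 < S.M k i) (hi : i ≤ S.ord k) :
    ∃ U, ∀ n, |(Polynomial.derivative^[i] (q n)).eval (S.a k)| ≤ U := by
  refine ⟨√(1 / S.M k i), fun n => Real.abs_le_sqrt ?_⟩
  rw [le_div_iff₀ hM, mul_comm]
  exact hq.weight_mul_sq_le_one n hi

/-- Needed at ±1, which θ may charge although `h` majorizes q_n only on ε_m. -/
theorem exists_abs_eval_le_of_atom (hq : S.IsOrthonormalSystem q) {e : ℝ} (he : S.θ {e} ≠ 0) :
    ∃ U, ∀ n, |(q n).eval e| ≤ U := by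
  have hpos : 0 < S.θ.real {e} := ENNReal.toReal_pos he (measure_ne_top _ _)
  refine ⟨√(1 / S.θ.real {e}), fun n => Real.abs_le_sqrt ?_⟩
  rw [le_div_iff₀ hpos, mul_comm]
  refine le_trans ?_ (hq.integral_sq_le_one n)
  have hint : Integrable (fun x => (q n).eval x ^ 2) S.θ :=
    (S.integrable_polynomial (q n ^ 2)).congr (ae_of_all _ fun x => Polynomial.eval_pow 2)
  have := setIntegral_le_integral (s := {e}) hint (ae_of_all _ fun x => sq_nonneg _)
  rwa [integral_singleton, smul_eq_mul] at this

theorem exists_kernel_bounds (hq : S.IsOrthonormalSystem q)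
    (hrec : Summable fun s : ℕ =>
      ∑ j ∈ Finset.Icc 1 (S.N + 1), (j : ℝ) * ∑ l ∈ Finset.Icc 0 (S.N + 1),
        (|S.recCoeff q (s + j) j - S.recCoeff q (s + j + l) j| +
          |S.recCoeff q (s + l) l - S.recCoeff q (s + j + l) l|)) :
    ∃ C : ℝ, ∀ (n : ℕ) (u v : ℕ → ℝ) (z y U V : ℝ),
      (∀ n, z * u n = ∑ m ∈ Finset.range (n + (S.N + 1) + 1), S.mulMatrix q n m * u m) →
      (∀ n, y * v n = ∑ m ∈ Finset.range (n + (S.N + 1) + 1), S.mulMatrix q n m * v m) →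
      (∀ k, |u k| ≤ U) → (∀ k, |v k| ≤ V) →
      |z - y| * |∑ i ∈ Finset.range n, u i * v i| ≤ C * U * V ∧
      |z - y| ^ 2 * |∑ i ∈ Finset.range n, ((n : ℝ) - i) * u i * v i| ≤ C * U * V := by
  refine _root_.exists_kernel_bounds mulMatrix_comm hq.mulMatrix_eq_zero fun l hl => ?_
  refine Summable.of_nonneg_of_le (fun _ => abs_nonneg _) (fun s => ?_) hrec
  have e : |S.mulMatrix q (s + l) s - S.mulMatrix q (s + 1 + l) (s + 1)| =
      |S.recCoeff q (s + l) l - S.recCoeff q (s + 1 + l) l| := by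
    rw [recCoeff_eq_mulMatrix, recCoeff_eq_mulMatrix]
  rw [e]
  -- The term j = 1 contains the variation of the l-th diagonal.
  refine le_trans ?_ (Finset.single_le_sum (f := fun j : ℕ =>
      (j : ℝ) * ∑ l ∈ Finset.Icc 0 (S.N + 1),
        (|S.recCoeff q (s + j) j - S.recCoeff q (s + j + l) j| +
          |S.recCoeff q (s + l) l - S.recCoeff q (s + j + l) l|)) (fun j _ => by positivity)
    (Finset.mem_Icc.mpr ⟨le_rfl, by omega⟩ : 1 ∈ Finset.Icc 1 (S.N + 1)))
  rw [Nat.cast_one, one_mul]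
  refine le_trans ?_ (Finset.single_le_sum (f := fun l : ℕ =>
        (|S.recCoeff q (s + 1) 1 - S.recCoeff q (s + 1 + l) 1| +
          |S.recCoeff q (s + l) l - S.recCoeff q (s + 1 + l) l|)) (fun j _ => by positivity)
    (Finset.mem_Icc.mpr ⟨Nat.zero_le l, hl⟩))
  exact le_add_of_nonneg_left (abs_nonneg _)

end IsOrthonormalSystem

end SobolevData

/-! ### Sums and integrals of staircase majorants. -/

theorem sum_range_inv_succ_le (n : ℕ) :
    ∑ k ∈ Finset.range n, 1 / ((k : ℝ) + 1) ≤ 1 + Real.log n := by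
  have := harmonic_le_one_add_log n
  unfold harmonic at this
  push_cast at this
  simpa only [one_div] using this

/-- `G x k` will be the integral over radius 1/(k+1), which is o(1/k) uniformly on K. Comparison
with the harmonic sum gives o(log n), the finitely many early terms and `R` being absorbed. -/
theorem eventually_add_mul_sum_le_mul_log {K : Set ℝ} {G : ℝ → ℕ → ℝ} {G₀ : ℝ} (hG₀ : 0 ≤ G₀)
    (hle : ∀ x ∈ K, ∀ k, G x k ≤ G₀)
    (ho : ∀ ε > 0, ∃ k₀, ∀ x ∈ K, ∀ k, k₀ ≤ k → G x k ≤ ε * (1 / ((k : ℝ) + 1)))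
    (R : ℝ) {A : ℝ} (hA : 0 ≤ A) :
    ∀ ε > 0, ∀ᶠ n : ℕ in atTop, ∀ x ∈ K,
      R + A * ∑ k ∈ Finset.range n, G x k ≤ ε * Real.log n := by
  intro ε hε
  obtain ⟨ε', hε', hAε⟩ : ∃ ε' > 0, A * ε' ≤ ε / 2 := by
    refine ⟨ε / 2 / (A + 1), by positivity, ?_⟩
    rw [mul_div_assoc', div_le_iff₀ (by positivity)]
    nlinarith
  obtain ⟨k₀, hk₀⟩ := ho ε' hε'
  have hlogt : Tendsto (fun n : ℕ => Real.log (n : ℝ)) atTop atTop :=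
    Real.tendsto_log_atTop.comp tendsto_natCast_atTop_atTop
  filter_upwards [hlogt.eventually_ge_atTop ((R + A * (ε' + k₀ * G₀)) / (ε / 2))] with n hn x hx
  rw [div_le_iff₀ (by positivity)] at hn
  have hterm : ∀ k, G x k ≤ ε' * (1 / ((k : ℝ) + 1)) + if k < k₀ then G₀ else 0 := fun k => by
    split_ifs with hk
    · have : 0 ≤ ε' * (1 / ((k : ℝ) + 1)) := by positivity
      linarith [hle x hx k]
    · linarith [hk₀ x hx k (by omega)]
  have hsum : ∑ k ∈ Finset.range n, G x k ≤ ε' * (1 + Real.log n) + k₀ * G₀ := by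
    refine (Finset.sum_le_sum fun k _ => hterm k).trans ?_
    rw [Finset.sum_add_distrib, ← Finset.mul_sum, ← Finset.sum_filter, Finset.sum_const,
      nsmul_eq_mul]
    refine add_le_add (mul_le_mul_of_nonneg_left (sum_range_inv_succ_le n) hε'.le)
      (mul_le_mul_of_nonneg_right ?_ hG₀)
    have : ((Finset.range n).filter (· < k₀)) ⊆ Finset.range k₀ := fun k hk =>
      Finset.mem_range.mpr (Finset.mem_filter.mp hk).2
    have := Finset.card_le_card this
    rw [Finset.card_range] at this
    exact_mod_cast this
  have h1 := mul_le_mul_of_nonneg_left hsum hA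
  have hlog0 : 0 ≤ Real.log n := Real.log_natCast_nonneg n
  have h2 := mul_le_mul_of_nonneg_right hAε hlog0
  linarith

/-- Only G = O(1/k) matters here: it cancels the linear weights and leaves bounded summands. -/
theorem exists_sum_weighted_le {K : Set ℝ} {G : ℝ → ℕ → ℝ} {G₀ : ℝ} (hG₀ : 0 ≤ G₀)
    (hle : ∀ x ∈ K, ∀ k, G x k ≤ G₀)
    (ho : ∀ ε > 0, ∃ k₀, ∀ x ∈ K, ∀ k, k₀ ≤ k → G x k ≤ ε * (1 / ((k : ℝ) + 1))) :
    ∃ C, ∀ x ∈ K, ∀ n : ℕ, ∑ k ∈ Finset.range n, (2 * (k : ℝ) + 3) * G x k ≤ C * n := by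
  obtain ⟨k₀, hk₀⟩ := ho 1 one_pos
  refine ⟨3 * (1 + (k₀ + 1) * G₀), fun x hx n => ?_⟩
  have hterm : ∀ k ∈ Finset.range n, (2 * (k : ℝ) + 3) * G x k ≤ 3 * (1 + (k₀ + 1) * G₀) := by
    intro k _
    have h1 : G x k ≤ (1 + (k₀ + 1) * G₀) * (1 / ((k : ℝ) + 1)) := by
      rcases le_or_gt k₀ k with hk | hk
      · refine (hk₀ x hx k hk).trans (mul_le_mul_of_nonneg_right ?_ (by positivity))
        have : 0 ≤ ((k₀ : ℝ) + 1) * G₀ := by positivity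
        linarith
      · refine (hle x hx k).trans ?_
        rw [mul_one_div, le_div_iff₀ (by positivity)]
        have : (k : ℝ) ≤ k₀ := by exact_mod_cast hk.le
        nlinarith
    have h0 : 0 ≤ (1 + (k₀ + 1) * G₀) := by positivity
    calc (2 * (k : ℝ) + 3) * G x k ≤ (2 * (k : ℝ) + 3) *
          ((1 + (k₀ + 1) * G₀) * (1 / ((k : ℝ) + 1))) :=
          mul_le_mul_of_nonneg_left h1 (by positivity)
      _ = (1 + (k₀ + 1) * G₀) * ((2 * (k : ℝ) + 3) / ((k : ℝ) + 1)) := by ring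
      _ ≤ (1 + (k₀ + 1) * G₀) * 3 := by
          refine mul_le_mul_of_nonneg_left ?_ h0
          rw [div_le_iff₀ (by positivity)]
          have : (0 : ℝ) ≤ k := Nat.cast_nonneg k
          linarith
      _ = _ := by ring
  calc _ ≤ ∑ k ∈ Finset.range n, 3 * (1 + (k₀ + 1) * G₀) := Finset.sum_le_sum hterm
    _ = _ := by rw [Finset.sum_const, Finset.card_range, nsmul_eq_mul]; ring

theorem abs_integral_mul_le_of_step_bound {μ : Measure ℝ} {f g P : ℝ → ℝ} {c x A : ℝ} {n : ℕ}
    {w : ℕ → ℝ} (hint : Integrable (fun t => |f t - c| * g t) μ)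
    (hP : ∀ᵐ t ∂μ, |P t| ≤ A * g t *
      (1 + ∑ k ∈ Finset.range n, if |t - x| ≤ 1 / ((k : ℝ) + 1) then w k else 0)) :
    |∫ t, (f t - c) * P t ∂μ| ≤ A * ((∫ t, |f t - c| * g t ∂μ) + ∑ k ∈ Finset.range n,
      w k * ∫ t in Icc (x - 1 / ((k : ℝ) + 1)) (x + 1 / ((k : ℝ) + 1)), |f t - c| * g t ∂μ) := by
  have hk : ∀ k : ℕ, Integrable (fun t => w k *
      (Icc (x - 1 / ((k : ℝ) + 1)) (x + 1 / ((k : ℝ) + 1))).indicator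
        (fun t => |f t - c| * g t) t) μ := fun k =>
    (hint.indicator measurableSet_Icc).const_mul _
  have hsum := integrable_finsetSum (Finset.range n) fun k _ => hk k
  have hb : Integrable (fun t => A * (|f t - c| * g t + ∑ k ∈ Finset.range n, w k *
      (Icc (x - 1 / ((k : ℝ) + 1)) (x + 1 / ((k : ℝ) + 1))).indicator
        (fun t => |f t - c| * g t) t)) μ := (hint.add hsum).const_mul A
  have h1 := norm_integral_le_of_norm_le (f := fun t => (f t - c) * P t) hb (by
    filter_upwards [hP] with t ht
    rw [Real.norm_eq_abs, abs_mul]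
    refine (mul_le_mul_of_nonneg_left ht (abs_nonneg _)).trans (le_of_eq ?_)
    have e : ∀ k : ℕ, (Icc (x - 1 / ((k : ℝ) + 1)) (x + 1 / ((k : ℝ) + 1))).indicator
        (fun t => |f t - c| * g t) t =
        if |t - x| ≤ 1 / ((k : ℝ) + 1) then |f t - c| * g t else 0 := fun k => by
      rw [indicator_apply]
      congr 1
      rw [mem_Icc, abs_le, eq_iff_iff]
      constructor <;> rintro ⟨h1, h2⟩ <;> constructor <;> linarith
    simp only [e, mul_ite, mul_zero]
    have e2 : ∑ k ∈ Finset.range n, (if |t - x| ≤ 1 / ((k : ℝ) + 1) then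
        w k * (|f t - c| * g t) else 0) = (∑ k ∈ Finset.range n,
        if |t - x| ≤ 1 / ((k : ℝ) + 1) then w k else 0) * (|f t - c| * g t) := by
      rw [Finset.sum_mul]
      exact Finset.sum_congr rfl fun k _ => by split_ifs <;> ring
    rw [e2]
    ring)
  rw [Real.norm_eq_abs, integral_const_mul, integral_add hint hsum,
    integral_finsetSum _ fun k _ => hk k] at h1
  simp only [integral_const_mul, integral_indicator measurableSet_Icc] at h1
  exact h1

/-! ### Growth of π_{N+1} and the kernel representation of the series. -/

namespace SobolevData

variable {S : SobolevData} {q : ℕ → Polynomial ℝ}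

theorem primW_sub (a b : ℝ) : S.primW b - S.primW a = ∫ t in a..b, S.w t :=
  intervalIntegral.integral_interval_sub_left (S.continuous_w.intervalIntegrable _ _)
    (S.continuous_w.intervalIntegrable _ _)

theorem monotone_primW : Monotone S.primW := fun a b hab => by
  rw [← sub_nonneg, primW_sub]
  exact intervalIntegral.integral_nonneg hab fun t _ => S.w_nonneg t

theorem mul_sub_le_primW_sub {a b c : ℝ} (hab : a ≤ b) (hw : ∀ t ∈ Icc a b, c ≤ S.w t) :
    c * (b - a) ≤ S.primW b - S.primW a := by
  rw [primW_sub]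
  have hi : IntervalIntegrable (fun _ => c) volume a b := intervalIntegrable_const
  have := intervalIntegral.integral_mono_on hab hi
    (S.continuous_w.intervalIntegrable a b) hw
  rwa [intervalIntegral.integral_const, smul_eq_mul, mul_comm] at this

theorem mul_abs_sub_le_abs_primW_sub {x δ c t : ℝ} (hδ : 0 < δ)
    (hsub : Icc (x - δ) (x + δ) ⊆ S.eps) (hc : 0 < c)
    (hw : ∀ t ∈ Icc (x - δ) (x + δ), c ≤ S.w t) (ht : t ∈ Icc (-1 : ℝ) 1) :
    c * δ / 2 * |t - x| ≤ |S.primW t - S.primW x| := by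
  have h1 := (hsub (left_mem_Icc.mpr (by linarith))).1
  have h2 := (hsub (right_mem_Icc.mpr (by linarith))).1
  have hx : x ∈ Icc (-1 : ℝ) 1 := ⟨by linarith [h1.1], by linarith [h2.2]⟩
  have hδ1 : δ ≤ 1 := by linarith [h1.1, h2.2]
  -- π gains at least c·min(|t-x|, δ) near x and, being monotone, loses nothing further out. Since
  -- |t-x| ≤ 2 and δ ≤ 1, this minimum is at least δ|t-x|/2.
  have aux : ∀ y s, 0 ≤ y → y ≤ 2 → s = min y δ → c * δ / 2 * y ≤ c * s := by
    rintro y s hy hy2 rfl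
    rw [mul_div_assoc, mul_assoc]
    refine mul_le_mul_of_nonneg_left (le_min ?_ ?_) hc.le <;> nlinarith
  rcases le_total x t with hxt | hxt
  · have hm := S.monotone_primW (min_le_left t (x + δ))
    have h3 := mul_sub_le_primW_sub (S := S) (c := c) (le_min hxt (by linarith) : x ≤ min t (x + δ))
      fun s hs => hw s ⟨by linarith [hs.1], hs.2.trans (min_le_right _ _)⟩
    rw [abs_of_nonneg (sub_nonneg.mpr hxt),
      abs_of_nonneg (sub_nonneg.mpr (S.monotone_primW hxt))]
    have h4 := aux (t - x) (min t (x + δ) - x) (by linarith) (by linarith [ht.2, hx.1])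
      (by rw [← min_sub_sub_right, add_sub_cancel_left])
    linarith
  · have hm := S.monotone_primW (le_max_left t (x - δ))
    have h3 := mul_sub_le_primW_sub (S := S) (c := c) (max_le hxt (by linarith) : max t (x - δ) ≤ x)
      fun s hs => hw s ⟨(le_max_right _ _).trans hs.1, by linarith [hs.2]⟩
    rw [abs_sub_comm, abs_of_nonneg (sub_nonneg.mpr hxt), abs_sub_comm,
      abs_of_nonneg (sub_nonneg.mpr (S.monotone_primW hxt))]
    have h4 := aux (x - t) (x - max t (x - δ)) (by linarith) (by linarith [ht.1, hx.2])
      (by rw [← min_sub_sub_left, sub_sub_cancel])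
    linarith

variable (q) in
/-- The kernel `∑_{i < n} ψ_i q_i(x) q_i` as a polynomial. -/
noncomputable def kernelPoly (ψ : ℕ → ℝ) (n : ℕ) (x : ℝ) : Polynomial ℝ :=
  ∑ i ∈ Finset.range n, (ψ i * (q i).eval x) • q i

theorem iterate_derivative_kernelPoly_eval (ψ : ℕ → ℝ) (n : ℕ) (x : ℝ) (i : ℕ) (t : ℝ) :
    (Polynomial.derivative^[i] (kernelPoly q ψ n x)).eval t =
      ∑ j ∈ Finset.range n, ψ j * (Polynomial.derivative^[i] (q j)).eval t * (q j).eval x := by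
  unfold kernelPoly
  simp only [Polynomial.iterate_derivative_sum, Polynomial.eval_finsetSum,
    Polynomial.iterate_derivative_smul, Polynomial.eval_smul, smul_eq_mul]
  exact Finset.sum_congr rfl fun j _ => by ring

theorem kernelPoly_eval (ψ : ℕ → ℝ) (n : ℕ) (x t : ℝ) :
    (kernelPoly q ψ n x).eval t =
      ∑ j ∈ Finset.range n, ψ j * (q j).eval t * (q j).eval x :=
  iterate_derivative_kernelPoly_eval ψ n x 0 t

theorem abs_kernelPoly_eval_le {ψ : ℕ → ℝ} {n : ℕ} {x t U V W : ℝ}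
    (hψ : ∀ j < n, |ψ j| ≤ W) (hU : ∀ j, |(q j).eval t| ≤ U) (hV : ∀ j, |(q j).eval x| ≤ V) :
    |(kernelPoly q ψ n x).eval t| ≤ n * (W * U * V) := by
  rw [kernelPoly_eval]
  refine (Finset.abs_sum_le_sum_abs _ _).trans ?_
  calc _ ≤ ∑ j ∈ Finset.range n, W * U * V := Finset.sum_le_sum fun j hj => by
        rw [abs_mul, abs_mul]
        have h1 := hψ j (Finset.mem_range.mp hj)
        have hW : 0 ≤ W := (abs_nonneg _).trans h1
        have hU0 : 0 ≤ U := (abs_nonneg _).trans (hU 0)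
        exact mul_le_mul (mul_le_mul h1 (hU j) (abs_nonneg _) hW) (hV j) (abs_nonneg _)
          (mul_nonneg hW hU0)
    _ = _ := by rw [Finset.sum_const, Finset.card_range, nsmul_eq_mul]

theorem pairing_sub {f : ℝ → ℝ} (hf : Integrable f S.θ) (c : ℝ) (F F₁ : Fin S.m → ℕ → ℝ)
    (P : Polynomial ℝ) : S.pairing (fun t => f t - c) (fun k i => F k i - c * F₁ k i) P =
      S.pairing f F P - c * S.pairing (fun _ => 1) F₁ P := by
  unfold pairing
  have h1 : ∫ t, (f t - c) * P.eval t ∂S.θ =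
      (∫ t, f t * P.eval t ∂S.θ) - c * ∫ t, 1 * P.eval t ∂S.θ := by
    rw [← integral_const_mul, ← integral_sub (S.integrable_mul_polynomial hf P)]
    · exact integral_congr_ae (ae_of_all _ fun t => by simp only; ring)
    · simpa using (S.integrable_polynomial P).const_mul c
  rw [h1, mul_add, add_sub_add_comm]
  congr 1
  simp only [Finset.mul_sum, ← Finset.sum_sub_distrib]
  exact Finset.sum_congr rfl fun k _ => Finset.sum_congr rfl fun i _ => by ring

/-- The expansion of the constant 1 has only its zeroth term, so centring f at a constant costs one
explicit term. -/
theorem IsOrthonormalSystem.ipPoly_one_mul_eval (hq : S.IsOrthonormalSystem q) (j : ℕ) (x : ℝ) :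
    S.ipPoly 1 (q j) * (q j).eval x = if j = 0 then 1 else 0 := by
  split_ifs with hj
  · subst hj
    have := hq.eq_sum_ipPoly 1 1 fun m hm => by
      rw [Polynomial.coeff_one, if_neg (by omega)]
    have := congrArg (Polynomial.eval x) this
    simpa using this.symm
  · rw [hq.ipPoly_eq_zero j 1 fun m hm => by rw [Polynomial.coeff_one, if_neg (by omega)],
      zero_mul]

/-- A weighted sum of the Fourier series, centred at `c`, as a pairing with the kernel. -/
theorem IsOrthonormalSystem.sum_mul_coeff_eq (hq : S.IsOrthonormalSystem q) {f : ℝ → ℝ}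
    (hf : Integrable f S.θ) (c : ℝ) (ψ : ℕ → ℝ) (n : ℕ) (x : ℝ) :
    ∑ i ∈ Finset.range n, ψ i * (S.coeff q f i * (q i).eval x) =
      S.pairing (fun t => f t - c)
        (fun k i => derivI i f (S.a k) - c * derivI i (fun t => (1 : Polynomial ℝ).eval t) (S.a k))
        (kernelPoly q ψ n x) + c * if 0 < n then ψ 0 else 0 := by
  have h1 : S.pairing (fun _ => 1)
      (fun k i => derivI i (fun t => (1 : Polynomial ℝ).eval t) (S.a k)) (kernelPoly q ψ n x) =
      if 0 < n then ψ 0 else 0 := by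
    have e : (fun _ : ℝ => (1 : ℝ)) = fun t => (1 : Polynomial ℝ).eval t := by
      ext t; simp
    rw [e, ← ip_eq_pairing]
    change S.ipPoly 1 (kernelPoly q ψ n x) = _
    unfold kernelPoly
    rw [S.ipPoly_sum_right]
    have e2 : ∀ j, ψ j * (q j).eval x * S.ipPoly 1 (q j) = if j = 0 then ψ 0 else 0 := fun j => by
      rw [mul_assoc, mul_comm ((q j).eval x), hq.ipPoly_one_mul_eval]
      split_ifs with hj
      · rw [hj, mul_one]
      · rw [mul_zero]
    simp only [e2, Finset.sum_ite_eq', Finset.mem_range]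
  rw [pairing_sub hf, h1, sub_add_cancel]
  unfold kernelPoly
  rw [S.pairing_sum hf]
  refine Finset.sum_congr rfl fun i _ => ?_
  unfold coeff
  rw [ip_eq_pairing]
  ring

end SobolevData

/-! ### Uniform convergence on sets of uniform Lebesgue points. -/

namespace SobolevData

variable {S : SobolevData} {q : ℕ → Polynomial ℝ}

theorem abs_pairing_le (g : ℝ → ℝ) (F : Fin S.m → ℕ → ℝ) (P : Polynomial ℝ) :
    |S.pairing g F P| ≤ |∫ t, g t * P.eval t ∂S.θ| +
      ∑ k : Fin S.m, ∑ i ∈ Finset.range (S.ord k + 1),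
        |F k i| * |S.M k i * (Polynomial.derivative^[i] P).eval (S.a k)| := by
  unfold pairing
  refine (abs_add_le _ _).trans (add_le_add_right ?_ _)
  refine (Finset.abs_sum_le_sum_abs _ _).trans (Finset.sum_le_sum fun k _ => ?_)
  refine (Finset.abs_sum_le_sum_abs _ _).trans (Finset.sum_le_sum fun i _ => le_of_eq ?_)
  rw [← abs_mul]
  congr 1
  ring

namespace IsOrthonormalSystem

/-- At a mass point with positive weight, the derivatives of the Dirichlet and Fejér kernels are
bounded uniformly over a set on which `π_{N+1}` stays away from its values at the mass points. -/
theorem exists_discrete_kernel_bound (hq : S.IsOrthonormalSystem q) {C : ℝ}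
    (hC : ∀ (n : ℕ) (u v : ℕ → ℝ) (z y U V : ℝ),
      (∀ n, z * u n = ∑ m ∈ Finset.range (n + (S.N + 1) + 1), S.mulMatrix q n m * u m) →
      (∀ n, y * v n = ∑ m ∈ Finset.range (n + (S.N + 1) + 1), S.mulMatrix q n m * v m) →
      (∀ k, |u k| ≤ U) → (∀ k, |v k| ≤ V) →
      |z - y| * |∑ i ∈ Finset.range n, u i * v i| ≤ C * U * V ∧
      |z - y| ^ 2 * |∑ i ∈ Finset.range n, ((n : ℝ) - i) * u i * v i| ≤ C * U * V)
    {K : Set ℝ} {η V : ℝ} (hη : 0 < η)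
    (hdist : ∀ x ∈ K, ∀ k, η ≤ |S.primW (S.a k) - S.primW x|)
    (hV : ∀ x ∈ K, ∀ j, |(q j).eval x| ≤ V) {k : Fin S.m} {i : ℕ} (hi : i ≤ S.ord k) :
    ∃ U, ∀ n : ℕ, ∀ x ∈ K,
      |S.M k i * (Polynomial.derivative^[i] (kernelPoly q (fun _ => 1) n x)).eval (S.a k)| ≤ U ∧
      |S.M k i * (Polynomial.derivative^[i]
        (kernelPoly q (fun j => (n : ℝ) - j) n x)).eval (S.a k)| ≤ U := by
  rcases (S.M_nonneg' hi).eq_or_lt with hM | hM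
  · exact ⟨0, fun n x _ => by simp [← hM]⟩
  obtain ⟨U, hU⟩ := hq.exists_abs_derivative_le hM hi
  refine ⟨max (S.M k i * (C * U * V / η)) (S.M k i * (C * U * V / η ^ 2)), fun n x hx => ?_⟩
  obtain ⟨h1, h2⟩ := hC n _ _ _ _ U V (hq.recurrence_derivative hi) (hq.recurrence_eval x)
    hU (hV x hx)
  simp only [iterate_derivative_kernelPoly_eval, one_mul]
  rw [abs_mul, abs_mul, abs_of_pos hM]
  constructor
  · refine le_trans (mul_le_mul_of_nonneg_left ?_ hM.le) (le_max_left _ _)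
    rw [le_div_iff₀ hη, mul_comm]
    exact (mul_le_mul_of_nonneg_right (hdist x hx k) (abs_nonneg _)).trans h1
  · refine le_trans (mul_le_mul_of_nonneg_left ?_ hM.le) (le_max_right _ _)
    rw [le_div_iff₀ (by positivity), mul_comm]
    refine (mul_le_mul_of_nonneg_right ?_ (abs_nonneg _)).trans h2
    exact pow_le_pow_left₀ hη.le (hdist x hx k) 2

/-- Counting terms gives the bounds with n and n²; the recurrence gives those with 1/|t-x| and its
square. The staircase lemmas merge each pair. -/
theorem abs_kernelPoly_eval_le_step {C c₀ : ℝ} (hc₀ : 0 < c₀) {n : ℕ}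
    {x t z y U V : ℝ} (hU : ∀ j, |(q j).eval t| ≤ U) (hV : ∀ j, |(q j).eval x| ≤ V)
    (hzy : c₀ * |t - x| ≤ |z - y|)
    (h1 : |z - y| * |∑ i ∈ Finset.range n, (q i).eval t * (q i).eval x| ≤ C * U * V)
    (h2 : |z - y| ^ 2 * |∑ i ∈ Finset.range n, ((n : ℝ) - i) * (q i).eval t * (q i).eval x| ≤
      C * U * V) :
    |(kernelPoly q (fun _ => 1) n x).eval t| ≤
      max 1 (max (C / c₀) (C / c₀ ^ 2)) * V * U *
        (1 + ∑ k ∈ Finset.range n, if |t - x| ≤ 1 / ((k : ℝ) + 1) then 1 else 0) ∧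
    |(kernelPoly q (fun j => (n : ℝ) - j) n x).eval t| ≤
      max 1 (max (C / c₀) (C / c₀ ^ 2)) * V * U *
        (1 + ∑ k ∈ Finset.range n, if |t - x| ≤ 1 / ((k : ℝ) + 1) then 2 * (k : ℝ) + 3 else 0) := by
  have hU0 : 0 ≤ U := (abs_nonneg _).trans (hU 0)
  have hV0 : 0 ≤ V := (abs_nonneg _).trans (hV 0)
  set B := max 1 (max (C / c₀) (C / c₀ ^ 2)) with hB
  have hB1 : C / c₀ ≤ B := (le_max_left _ _).trans (le_max_right _ _)
  have hB2 : C / c₀ ^ 2 ≤ B := (le_max_right _ _).trans (le_max_right _ _)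
  have hVU : 0 ≤ V * U := mul_nonneg hV0 hU0
  rw [mul_assoc B V U]
  constructor
  · refine le_mul_one_add_sum_ite (le_max_left _ _) hVU (abs_nonneg _) ?_ ?_
    · refine (abs_kernelPoly_eval_le (W := 1) (fun j _ => by simp) hU hV).trans (le_of_eq ?_)
      ring
    · refine le_trans ?_ (mul_le_mul_of_nonneg_right hB1 hVU)
      rw [div_mul_eq_mul_div, le_div_iff₀ hc₀, kernelPoly_eval]
      simp only [one_mul]
      refine le_trans (le_of_eq ?_) ((mul_le_mul_of_nonneg_right hzy (abs_nonneg _)).trans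
        (h1.trans (le_of_eq ?_))) <;> ring
  · refine le_mul_one_add_sum_ite_sq (le_max_left _ _) hVU (abs_nonneg _) ?_ ?_
    · refine (abs_kernelPoly_eval_le (W := n) (fun j hj => ?_) hU hV).trans (le_of_eq ?_)
      · have hj' : (j : ℝ) < n := by exact_mod_cast hj
        have hj0 : (0 : ℝ) ≤ j := Nat.cast_nonneg j
        rw [abs_of_pos (by linarith)]
        linarith
      · ring
    · refine le_trans ?_ (mul_le_mul_of_nonneg_right hB2 hVU)
      rw [div_mul_eq_mul_div, le_div_iff₀ (by positivity), kernelPoly_eval]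
      have h3 : (c₀ * |t - x|) ^ 2 ≤ |z - y| ^ 2 := pow_le_pow_left₀ (by positivity) hzy 2
      refine le_trans (le_of_eq ?_) ((mul_le_mul_of_nonneg_right h3 (abs_nonneg _)).trans
        (h2.trans (le_of_eq ?_))) <;> ring

/-- Uniform convergence of the multiplier series on a set of points that are uniformly Lebesgue
points of `f` for the measure `g θ`, where `g` is a majorant of the polynomials `q`. -/
theorem exists_tendstoUniformlyOn_multSum (hq : S.IsOrthonormalSystem q)
    (hrec : Summable fun s : ℕ =>
      ∑ j ∈ Finset.Icc 1 (S.N + 1), (j : ℝ) * ∑ l ∈ Finset.Icc 0 (S.N + 1),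
        (|S.recCoeff q (s + j) j - S.recCoeff q (s + j + l) j| +
          |S.recCoeff q (s + l) l - S.recCoeff q (s + j + l) l|))
    {φ : ℕ → ℝ} (hφ : IsQuasiconvex φ)
    (hlog : φ =O[atTop] fun k : ℕ => 1 / Real.log (k : ℝ))
    {f g : ℝ → ℝ} (hf : Integrable f S.θ) (hg : Integrable g S.θ)
    (hfg : Integrable (fun t => |f t| * g t) S.θ)
    (hqg : ∀ᵐ t ∂S.θ, ∀ j, |(q j).eval t| ≤ g t)
    {K : Set ℝ} {c : ℝ → ℝ} {δ c₁ V B : ℝ} (hδ : 0 < δ)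
    (hK : ∀ x ∈ K, Icc (x - δ) (x + δ) ⊆ S.eps) (hc₁ : 0 < c₁)
    (hw : ∀ x ∈ K, ∀ t ∈ Icc (x - δ) (x + δ), c₁ ≤ S.w t)
    (hV : ∀ x ∈ K, ∀ j, |(q j).eval x| ≤ V) (hB : ∀ x ∈ K, |c x| ≤ B)
    (hLeb : ∀ ε > 0, ∃ ρ > 0, ∀ x ∈ K, ∀ r, 0 < r → r ≤ ρ →
      ∫ t in Icc (x - r) (x + r), |f t - c x| * g t ∂S.θ ≤ ε * r) :
    ∃ T : ℝ → ℝ, TendstoUniformlyOn (fun n x => S.multSum q φ f n x) T atTop K := by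
  obtain ⟨C, hC⟩ := hq.exists_kernel_bounds hrec
  rcases K.eq_empty_or_nonempty with rfl | ⟨x₀, hx₀⟩
  · exact ⟨0, tendstoUniformlyOn_empty⟩
  have hV0 : 0 ≤ V := (abs_nonneg _).trans (hV x₀ hx₀ 0)
  have hB0 : 0 ≤ B := (abs_nonneg _).trans (hB x₀ hx₀)
  set c₀ := c₁ * δ / 2 with hc₀def
  have hc₀ : 0 < c₀ := by positivity
  have hlow : ∀ x ∈ K, ∀ t ∈ Icc (-1 : ℝ) 1, c₀ * |t - x| ≤ |S.primW t - S.primW x| :=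
    fun x hx t ht => mul_abs_sub_le_abs_primW_sub hδ (hK x hx) hc₁ (hw x hx) ht
  -- No mass point lies within δ of K, since the δ-intervals stay in ε_m.
  have hdist : ∀ x ∈ K, ∀ k, c₀ * δ ≤ |S.primW (S.a k) - S.primW x| := fun x hx k => by
    refine le_trans (mul_le_mul_of_nonneg_left ?_ hc₀.le) (hlow x hx _ (S.a_mem k))
    by_contra hlt
    rw [not_le, abs_lt] at hlt
    exact (hK x hx ⟨by linarith [hlt.1], by linarith [hlt.2]⟩ : S.a k ∈ S.eps).2 ⟨k, rfl⟩
  have hdisc : ∀ (k : Fin S.m) (i : ℕ), ∃ U, i ≤ S.ord k → ∀ n : ℕ, ∀ x ∈ K,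
      |S.M k i * (Polynomial.derivative^[i] (kernelPoly q (fun _ => 1) n x)).eval (S.a k)| ≤ U ∧
      |S.M k i * (Polynomial.derivative^[i]
        (kernelPoly q (fun j => (n : ℝ) - j) n x)).eval (S.a k)| ≤ U := fun k i => by
    by_cases hi : i ≤ S.ord k
    · obtain ⟨U, hU⟩ := hq.exists_discrete_kernel_bound hC (mul_pos hc₀ hδ) hdist hV hi
      exact ⟨U, fun _ => hU⟩
    · exact ⟨0, fun h => absurd h hi⟩
  choose U hU using hdisc
  set F : ℝ → Fin S.m → ℕ → ℝ := fun x k i => derivI i f (S.a k) -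
    c x * derivI i (fun t => (1 : Polynomial ℝ).eval t) (S.a k) with hF
  set D := ∑ k : Fin S.m, ∑ i ∈ Finset.range (S.ord k + 1), (|derivI i f (S.a k)| +
    B * |derivI i (fun t => (1 : Polynomial ℝ).eval t) (S.a k)|) * U k i with hD
  have hFle : ∀ x ∈ K, ∀ k i, |F x k i| ≤ |derivI i f (S.a k)| +
      B * |derivI i (fun t => (1 : Polynomial ℝ).eval t) (S.a k)| := fun x hx k i => by
    refine (abs_sub _ _).trans (add_le_add_right ?_ _)
    rw [abs_mul]
    exact mul_le_mul_of_nonneg_right (hB x hx) (abs_nonneg _)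
  have hDle : ∀ x ∈ K, ∀ P : Polynomial ℝ, (∀ k, ∀ i ≤ S.ord k,
      |S.M k i * (Polynomial.derivative^[i] P).eval (S.a k)| ≤ U k i) →
      |S.pairing (fun t => f t - c x) (F x) P| ≤
        |∫ t, (f t - c x) * P.eval t ∂S.θ| + D := fun x hx P hP => by
    refine (abs_pairing_le _ _ _).trans (add_le_add_right ?_ _)
    refine Finset.sum_le_sum fun k _ => Finset.sum_le_sum fun i hi => ?_
    refine mul_le_mul (hFle x hx k i) (hP k i (Nat.lt_succ_iff.mp (Finset.mem_range.mp hi)))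
      (abs_nonneg _) (by positivity)
  have hg0 : ∀ᵐ t ∂S.θ, 0 ≤ g t := hqg.mono fun t ht => (abs_nonneg _).trans (ht 0)
  have hint : ∀ x, Integrable (fun t => |f t - c x| * g t) S.θ := fun x => by
    refine (hfg.add (hg.const_mul |c x|)).mono'
      ((hf.aestronglyMeasurable.sub aestronglyMeasurable_const).norm.mul
        hg.aestronglyMeasurable) ?_
    filter_upwards [hg0] with t ht
    rw [Real.norm_eq_abs, abs_mul, abs_abs, abs_of_nonneg ht, Pi.add_apply, ← add_mul]
    exact mul_le_mul_of_nonneg_right (abs_sub _ _) ht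
  have hpos : ∀ x, ∀ᵐ t ∂S.θ, 0 ≤ |f t - c x| * g t := fun x =>
    hg0.mono fun t ht => mul_nonneg (abs_nonneg _) ht
  set G₀ := (∫ t, |f t| * g t ∂S.θ) + B * ∫ t, g t ∂S.θ with hG₀def
  have htot : ∀ x ∈ K, ∫ t, |f t - c x| * g t ∂S.θ ≤ G₀ := fun x hx => by
    rw [hG₀def, ← integral_const_mul, ← integral_add hfg (hg.const_mul B)]
    refine integral_mono_ae (hint x) (hfg.add (hg.const_mul B)) ?_
    filter_upwards [hg0] with t ht
    rw [← add_mul]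
    exact mul_le_mul_of_nonneg_right ((abs_sub _ _).trans (add_le_add_right (hB x hx) _)) ht
  have hG₀ : 0 ≤ G₀ := (integral_nonneg_of_ae (hpos x₀)).trans (htot x₀ hx₀)
  set G : ℝ → ℕ → ℝ := fun x k =>
    ∫ t in Icc (x - 1 / ((k : ℝ) + 1)) (x + 1 / ((k : ℝ) + 1)), |f t - c x| * g t ∂S.θ with hGdef
  have hGle : ∀ x ∈ K, ∀ k, G x k ≤ G₀ := fun x hx k =>
    (setIntegral_le_integral (hint x) (hpos x)).trans (htot x hx)
  have hGo : ∀ ε > 0, ∃ k₀, ∀ x ∈ K, ∀ k, k₀ ≤ k → G x k ≤ ε * (1 / ((k : ℝ) + 1)) := by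
    intro ε hε
    obtain ⟨ρ, hρ, h⟩ := hLeb ε hε
    obtain ⟨k₀, hk₀⟩ := exists_nat_one_div_lt hρ
    refine ⟨k₀, fun x hx k hk => h x hx _ (by positivity) (le_trans ?_ hk₀.le)⟩
    have : (k₀ : ℝ) ≤ k := by exact_mod_cast hk
    gcongr
  set A := max 1 (max (C / c₀) (C / c₀ ^ 2)) * V with hAdef
  have hA : 0 ≤ A := mul_nonneg (zero_le_one.trans (le_max_left _ _)) hV0
  have hker : ∀ n : ℕ, ∀ x ∈ K, ∀ᵐ t ∂S.θ,
      |(kernelPoly q (fun _ => 1) n x).eval t| ≤ A * g t *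
        (1 + ∑ k ∈ Finset.range n, if |t - x| ≤ 1 / ((k : ℝ) + 1) then 1 else 0) ∧
      |(kernelPoly q (fun j => (n : ℝ) - j) n x).eval t| ≤ A * g t *
        (1 + ∑ k ∈ Finset.range n,
          if |t - x| ≤ 1 / ((k : ℝ) + 1) then 2 * (k : ℝ) + 3 else 0) := fun n x hx => by
    filter_upwards [hqg, S.ae_mem_Icc] with t ht htI
    obtain ⟨h1, h2⟩ := hC n _ _ _ _ _ V (hq.recurrence_eval t) (hq.recurrence_eval x) ht (hV x hx)
    exact abs_kernelPoly_eval_le_step hc₀ ht (hV x hx) (hlow x hx t htI) h1 h2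
  obtain ⟨CF, hCF⟩ := exists_sum_weighted_le hG₀ hGle hGo
  have hAG : ∀ x ∈ K, A * ∫ t, |f t - c x| * g t ∂S.θ ≤ A * G₀ := fun x hx =>
    mul_le_mul_of_nonneg_left (htot x hx) hA
  -- Four contributions: the mass points (`D`), the constant 1 of the staircase (`A * G₀`), the
  -- centring constant (`B`), and the shrinking intervals.
  have hD0 : ∀ n : ℕ, ∀ x ∈ K, |∑ i ∈ Finset.range n, S.coeff q f i * (q i).eval x| ≤
      (D + A * G₀ + B) + A * ∑ k ∈ Finset.range n, G x k := fun n x hx => by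
    have e := hq.sum_mul_coeff_eq hf (c x) (fun _ => 1) n x
    simp only [one_mul] at e
    rw [e]
    refine (abs_add_le _ _).trans ?_
    have h1 := hDle x hx _ fun k i hi => (hU k i hi n x hx).1
    have h2 := abs_integral_mul_le_of_step_bound (hint x) ((hker n x hx).mono fun t ht => ht.1)
    simp only [one_mul] at h2
    have h3 : |c x * if 0 < n then 1 else 0| ≤ B := by
      split_ifs
      · rw [mul_one]; exact hB x hx
      · rw [mul_zero, abs_zero]; exact hB0
    rw [mul_add] at h2
    linarith [hAG x hx]
  have hF0 : ∀ n : ℕ, ∀ x ∈ K,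
      |∑ i ∈ Finset.range n, ((n : ℝ) - i) * (S.coeff q f i * (q i).eval x)| ≤
      (|D| + A * G₀ + B + A * CF) * n := fun n x hx => by
    rcases Nat.eq_zero_or_pos n with rfl | hn
    · simp
    have hn1 : (1 : ℝ) ≤ n := by exact_mod_cast hn
    rw [hq.sum_mul_coeff_eq hf (c x) (fun j => (n : ℝ) - j) n x]
    refine (abs_add_le _ _).trans ?_
    have h1 := hDle x hx _ fun k i hi => (hU k i hi n x hx).2
    have h2 := abs_integral_mul_le_of_step_bound (hint x) ((hker n x hx).mono fun t ht => ht.2)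
    have h3 : |c x * if 0 < n then (n : ℝ) - (0 : ℕ) else 0| ≤ B * n := by
      rw [if_pos hn, Nat.cast_zero, sub_zero, abs_mul, Nat.abs_cast]
      exact mul_le_mul_of_nonneg_right (hB x hx) (Nat.cast_nonneg n)
    have h4 := mul_le_mul_of_nonneg_left (hCF x hx n) hA
    have h5 : |D| + A * G₀ ≤ (|D| + A * G₀) * n :=
      le_mul_of_one_le_right (by positivity) hn1
    rw [mul_add] at h2
    have h6 := le_abs_self D
    have h7 := hAG x hx
    nlinarith
  obtain ⟨T, hT⟩ := exists_tendstoUniformlyOn_of_quasiconvex hφ hlog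
    (a := fun i x => S.coeff q f i * (q i).eval x) hF0 (by
      intro ε hε
      filter_upwards [eventually_add_mul_sum_le_mul_log hG₀ hGle hGo (D + A * G₀ + B) hA ε hε]
        with n hn x hx
      exact (hD0 n x hx).trans (hn x hx))
  refine ⟨T, hT.congr (Eventually.of_forall fun n x _ => ?_)⟩
  unfold multSum
  exact Finset.sum_congr rfl fun k _ => by ring

end IsOrthonormalSystem

end SobolevData

/-! ### Lebesgue points almost everywhere. -/

theorem integrable_abs_of_integrable_abs_rpow {μ : Measure ℝ} [IsFiniteMeasure μ] {k : ℝ → ℝ}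
    {p : ℝ} (hp : 1 ≤ p) (hk : Integrable (fun t => |k t| ^ p) μ) :
    Integrable (fun t => |k t|) μ := by
  have hmeas : AEStronglyMeasurable (fun t => |k t|) μ := by
    -- Measurability of `k` is not assumed; |k| is recovered as the p-th root of |k|^p.
    refine ((hk.aestronglyMeasurable.aemeasurable.pow_const p⁻¹).congr
      (ae_of_all _ fun t => ?_)).aestronglyMeasurable
    exact Real.rpow_rpow_inv (abs_nonneg _) (by linarith)
  refine (hk.add (integrable_const (1 : ℝ))).mono' hmeas (ae_of_all _ fun t => ?_)
  rw [Real.norm_eq_abs, abs_abs, Pi.add_apply]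
  have h0 : 0 ≤ |k t| ^ p := by positivity
  rcases le_total |k t| 1 with h | h
  · linarith
  · linarith [Real.self_le_rpow_of_one_le h hp]

/-- Besicovitch differentiation of kμ against Lebesgue measure; μ may have a singular part. The
factor 2 comes from the interval length 2r. -/
theorem ae_tendsto_inv_mul_setIntegral_Icc {μ : Measure ℝ} [IsFiniteMeasure μ] {k : ℝ → ℝ}
    (hk : Measurable k) (hk0 : ∀ t, 0 ≤ k t) (hint : Integrable k μ) :
    ∀ᵐ x ∂(volume : Measure ℝ), Tendsto (fun r : ℝ => r⁻¹ * ∫ t in Icc (x - r) (x + r), k t ∂μ)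
      (𝓝[>] 0) (𝓝 (2 * (k x * (μ.rnDeriv volume x).toReal))) := by
  set ρ := μ.withDensity fun t => ENNReal.ofReal (k t) with hρ
  have : IsFiniteMeasure ρ := isFiniteMeasure_withDensity_ofReal hint.hasFiniteIntegral
  have h1 := Besicovitch.ae_tendsto_rnDeriv ρ (volume : Measure ℝ)
  have h2 : ρ.rnDeriv volume =ᵐ[volume] fun x => ENNReal.ofReal (k x) * μ.rnDeriv volume x :=
    Measure.rnDeriv_withDensity_left hk.ennreal_ofReal.aemeasurable
      (ae_of_all _ fun t => ENNReal.ofReal_ne_top)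
  filter_upwards [h1, h2, ρ.rnDeriv_lt_top volume] with x hx hx2 hx3
  have h4 := ((ENNReal.tendsto_toReal hx3.ne).comp hx).const_mul 2
  rw [hx2, ENNReal.toReal_mul, ENNReal.toReal_ofReal (hk0 x)] at h4
  refine h4.congr' ?_
  filter_upwards [self_mem_nhdsWithin] with r hr
  have hr : 0 < r := hr
  have e : ρ (Metric.closedBall x r) = ENNReal.ofReal (∫ t in Icc (x - r) (x + r), k t ∂μ) := by
    rw [Real.closedBall_eq_Icc, hρ, withDensity_apply _ measurableSet_Icc,
      ofReal_integral_eq_lintegral_ofReal hint.restrict (ae_of_all _ hk0)]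
  rw [Function.comp, e, Real.volume_closedBall, ENNReal.toReal_div,
    ENNReal.toReal_ofReal (setIntegral_nonneg measurableSet_Icc fun t _ => hk0 t),
    ENNReal.toReal_ofReal (by positivity)]
  field_simp

/-- Lebesgue-almost every point is a Lebesgue point of `f` for the measure `g μ`, up to changing
the value of `f` there. -/
theorem ae_exists_tendsto_inv_mul_setIntegral_abs_sub {μ : Measure ℝ} [IsFiniteMeasure μ]
    {f g : ℝ → ℝ} (hf : AEStronglyMeasurable f μ) (hg : Integrable g μ)
    (hg0 : ∀ᵐ t ∂μ, 0 ≤ g t) (hfg : Integrable (fun t => |f t| * g t) μ) :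
    ∀ᵐ x ∂(volume : Measure ℝ), ∃ c : ℝ, Tendsto
      (fun r : ℝ => r⁻¹ * ∫ t in Icc (x - r) (x + r), |f t - c| * g t ∂μ) (𝓝[>] 0) (𝓝 0) := by
  set f' := hf.mk f with hf'
  set g' : ℝ → ℝ := fun t => |hg.aestronglyMeasurable.mk g t| with hg'
  have hfm : Measurable f' := hf.stronglyMeasurable_mk.measurable
  have hgm : Measurable g' := hg.aestronglyMeasurable.stronglyMeasurable_mk.measurable.abs
  have hg'0 : ∀ t, 0 ≤ g' t := fun t => abs_nonneg _
  have hff : f =ᵐ[μ] f' := hf.ae_eq_mk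
  have hgg : g =ᵐ[μ] g' := by
    filter_upwards [hg.aestronglyMeasurable.ae_eq_mk, hg0] with t h1 h2
    simp only [hg']
    rw [← h1, abs_of_nonneg h2]
  have hgi : Integrable g' μ := hg.congr hgg
  have hfgi : Integrable (fun t => |f' t| * g' t) μ := hfg.congr (by
    filter_upwards [hff, hgg] with t h1 h2
    rw [h1, h2])
  have hci : ∀ c : ℝ, Integrable (fun t => |f' t - c| * g' t) μ := fun c => by
    refine (hfgi.add (hgi.const_mul |c|)).mono'
      (((hfm.sub_const c).abs.mul hgm).aestronglyMeasurable) (ae_of_all _ fun t => ?_)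
    rw [Real.norm_eq_abs, abs_mul, abs_abs, abs_of_nonneg (hg'0 t), Pi.add_apply, ← add_mul]
    exact mul_le_mul_of_nonneg_right (abs_sub _ _) (hg'0 t)
  -- Rational centres leave one exceptional null set; a real centre is then approximated by them.
  have h1 : ∀ᵐ x ∂(volume : Measure ℝ), ∀ a : ℚ, Tendsto
      (fun r : ℝ => r⁻¹ * ∫ t in Icc (x - r) (x + r), |f' t - a| * g' t ∂μ)
      (𝓝[>] 0) (𝓝 (2 * (|f' x - a| * g' x * (μ.rnDeriv volume x).toReal))) :=
    ae_all_iff.mpr fun a => ae_tendsto_inv_mul_setIntegral_Icc ((hfm.sub_const (a : ℝ)).abs.mul hgm)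
      (fun t => mul_nonneg (abs_nonneg _) (hg'0 t)) (hci a)
  filter_upwards [h1, ae_tendsto_inv_mul_setIntegral_Icc hgm hg'0 hgi] with x hx1 hx2
  -- The centre is the value of a measurable representative: μ may be singular, and f may differ
  -- from it at x.
  refine ⟨f' x, ?_⟩
  have hcongr : ∀ r : ℝ, ∫ t in Icc (x - r) (x + r), |f t - f' x| * g t ∂μ =
      ∫ t in Icc (x - r) (x + r), |f' t - f' x| * g' t ∂μ := fun r =>
    integral_congr_ae (ae_restrict_of_ae (by
      filter_upwards [hff, hgg] with t h1 h2
      rw [h1, h2]))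
  simp only [hcongr]
  set d := g' x * (μ.rnDeriv volume x).toReal with hd
  have hd0 : 0 ≤ d := mul_nonneg (hg'0 x) ENNReal.toReal_nonneg
  rw [Metric.tendsto_nhds]
  intro ε hε
  -- The two limits below add up to 4d|f'(x) - a|; the +1 covers d = 0.
  obtain ⟨a, ha⟩ := exists_rat_btwn (show f' x < f' x + ε / (4 * d + 1) from
    lt_add_of_pos_right _ (by positivity))
  have hax : |f' x - a| * (4 * d + 1) < ε := by
    rw [← lt_div_iff₀ (by positivity), abs_sub_comm, abs_of_pos (by linarith [ha.1])]
    linarith [ha.2]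
  have hlim := (hx1 a).add (hx2.const_mul |f' x - a|)
  have hlt : 2 * (|f' x - a| * g' x * (μ.rnDeriv volume x).toReal) + |f' x - a| * (2 * d) < ε := by
    have : 0 ≤ |f' x - a| := abs_nonneg _
    rw [mul_assoc, ← hd]
    nlinarith
  filter_upwards [hlim.eventually (gt_mem_nhds hlt), self_mem_nhdsWithin] with r hr hr0
  have hr0 : 0 < r := hr0
  rw [Real.dist_eq, sub_zero, abs_of_nonneg (mul_nonneg (by positivity)
    (setIntegral_nonneg measurableSet_Icc fun t _ => mul_nonneg (abs_nonneg _) (hg'0 t)))]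
  refine lt_of_le_of_lt ?_ hr
  rw [mul_left_comm, ← mul_add]
  refine mul_le_mul_of_nonneg_left ?_ (by positivity)
  rw [← integral_const_mul, ← integral_add (hci a).integrableOn (hgi.const_mul _).integrableOn]
  refine integral_mono (hci _).integrableOn
    ((hci a).integrableOn.add (hgi.const_mul _).integrableOn) fun t => ?_
  simp only
  rw [← add_mul]
  refine mul_le_mul_of_nonneg_right ?_ (hg'0 t)
  rw [abs_sub_comm (f' x)]
  exact abs_sub_le _ _ _

/-! ### Compactness in ε_m and an integrable majorant. -/

namespace SobolevData

variable {S : SobolevData} {q : ℕ → Polynomial ℝ}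

theorem isOpen_eps : IsOpen S.eps :=
  isOpen_Ioo.sdiff (finite_range S.a).isClosed

theorem exists_uniform_neighbourhood {K : Set ℝ} (hK : IsCompact K) (hKe : K ⊆ S.eps) :
    ∃ δ c₁ : ℝ, ∃ K' : Set ℝ, 0 < δ ∧ 0 < c₁ ∧ IsCompact K' ∧ K' ⊆ S.eps ∧
      (∀ x ∈ K, Icc (x - δ) (x + δ) ⊆ K') ∧ ∀ t ∈ K', c₁ ≤ S.w t := by
  obtain ⟨δ, hδ, hsub⟩ := hK.exists_cthickening_subset_open S.isOpen_eps hKe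
  obtain ⟨c₁, hc₁, hw⟩ := (hK.cthickening (r := δ)).exists_forall_le'
    S.continuous_w.continuousOn fun t ht => S.w_pos (hsub ht)
  refine ⟨δ, c₁, _, hδ, hc₁, hK.cthickening, hsub, fun x hx t ht => ?_, hw⟩
  rw [← Real.closedBall_eq_Icc] at ht
  exact Metric.closedBall_subset_cthickening hx δ ht

namespace IsOrthonormalSystem

/-- Off ε_m, θ-almost every point is ±1. Such an endpoint is either an atom, where normalization
bounds all q_n, or null; so a constant extends `h` there. -/
theorem exists_majorant (hq : S.IsOrthonormalSystem q) {h f : ℝ → ℝ}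
    (hbound : ∀ k, ∀ t ∈ S.eps, |(q k).eval t| ≤ h t) {p : ℝ} (hp : 1 ≤ p)
    (hf : Integrable f S.θ) (hfh : Integrable (fun t => |f t| ^ p * |h t| ^ p) S.θ)
    (hh : Integrable (fun t => |h t| ^ p) S.θ) :
    ∃ g : ℝ → ℝ, (∀ t ∈ S.eps, g t = h t) ∧ Integrable g S.θ ∧
      Integrable (fun t => |f t| * g t) S.θ ∧ ∀ᵐ t ∂S.θ, ∀ j, |(q j).eval t| ≤ g t := by
  have hatom : ∀ e : ℝ, ∃ U, S.θ {e} ≠ 0 → ∀ n, |(q n).eval e| ≤ U := fun e => by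
    by_cases he : S.θ {e} = 0
    · exact ⟨0, fun h => absurd he h⟩
    · obtain ⟨U, hU⟩ := hq.exists_abs_eval_le_of_atom he
      exact ⟨U, fun _ => hU⟩
  choose U hU using hatom
  have hnull : ∀ e : ℝ, ∀ᵐ t ∂S.θ, t = e → S.θ {e} ≠ 0 := fun e => by
    by_cases he : S.θ {e} = 0
    · filter_upwards [measure_eq_zero_iff_ae_notMem.mp he] with t ht hte
      exact absurd hte ht
    · exact ae_of_all _ fun t _ => he
  have hi := integrable_abs_of_integrable_abs_rpow hp hh
  have hfi : Integrable (fun t => |f t| * |h t|) S.θ := by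
    have := integrable_abs_of_integrable_abs_rpow (k := fun t => f t * h t) hp (by
      simpa only [abs_mul, Real.mul_rpow (abs_nonneg _) (abs_nonneg _)] using hfh)
    simpa only [abs_mul] using this
  have hme := S.isOpen_eps.measurableSet
  refine ⟨fun t => S.eps.indicator (fun t => |h t|) t +
    S.epsᶜ.indicator (fun _ => max (U (-1)) (U 1)) t, fun t ht => ?_, ?_, ?_, ?_⟩
  · simp [ht, abs_of_nonneg ((abs_nonneg _).trans (hbound 0 t ht))]
  · exact (hi.indicator hme).add ((integrable_const _).indicator hme.compl)
  · refine ((hfi.indicator hme).add ((hf.abs.mul_const (max (U (-1)) (U 1))).indicator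
      hme.compl)).congr (ae_of_all _ fun t => ?_)
    by_cases ht : t ∈ S.eps <;> simp [ht]
  · have hall : ∀ᵐ t ∂S.θ, ∀ k, t ≠ S.a k := ae_all_iff.mpr fun k =>
      measure_eq_zero_iff_ae_notMem.mp (S.θ_a k)
    filter_upwards [S.ae_mem_Icc, hall, hnull (-1), hnull 1] with t hI ha h1 h2 j
    by_cases ht : t ∈ S.eps
    · simpa [ht] using (hbound j t ht).trans (le_abs_self _)
    · have : t = -1 ∨ t = 1 := by
        by_contra hne
        rw [not_or] at hne
        refine ht ⟨⟨lt_of_le_of_ne hI.1 (Ne.symm hne.1), lt_of_le_of_ne hI.2 hne.2⟩, ?_⟩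
        rintro ⟨k, hk⟩
        exact ha k hk.symm
      simp only [ht, not_false_eq_true, indicator_of_notMem, mem_compl_iff, indicator_of_mem,
        zero_add]
      rcases this with rfl | rfl
      · exact (hU _ (h1 rfl) j).trans (le_max_left _ _)
      · exact (hU _ (h2 rfl) j).trans (le_max_right _ _)

end IsOrthonormalSystem

theorem exists_forall_le_of_isBoundedUnder {h : ℝ → ℝ} {K : Set ℝ} (hK : IsCompact K)
    (hb : ∀ x ∈ K, (𝓝 x).IsBoundedUnder (· ≤ ·) h) : ∃ B, ∀ t ∈ K, h t ≤ B := by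
  refine hK.induction_on (p := fun s => ∃ B, ∀ t ∈ s, h t ≤ B) ⟨0, by simp⟩
    (fun s t hst ⟨B, hB⟩ => ⟨B, fun x hx => hB x (hst hx)⟩) ?_ fun x hx => ?_
  · rintro s t ⟨B, hB⟩ ⟨B', hB'⟩
    refine ⟨max B B', fun x hx => ?_⟩
    rcases hx with hx | hx
    · exact (hB x hx).trans (le_max_left _ _)
    · exact (hB' x hx).trans (le_max_right _ _)
  · obtain ⟨B, hB⟩ := hb x hx
    exact ⟨_, mem_nhdsWithin_of_mem_nhds (eventually_map.mp hB), B, fun t ht => ht⟩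

/-- A density bounded by `W` on an interval gives it mass at most `W` times its length. -/
theorem measureReal_Icc_le_of_withDensity {μ : Measure ℝ} {ω : ℝ → ℝ} {s : Set ℝ} {x r W : ℝ}
    (hμ : μ = (volume.restrict s).withDensity (fun x => ENNReal.ofReal (ω x))) (hr : 0 ≤ r)
    (hW0 : 0 ≤ W) (hW : ∀ t ∈ Icc (x - r) (x + r), ω t ≤ W) :
    μ.real (Icc (x - r) (x + r)) ≤ W * (2 * r) := by
  rw [Measure.real]
  refine ENNReal.toReal_le_of_le_ofReal (by positivity) ?_
  rw [hμ, withDensity_apply _ measurableSet_Icc, Measure.restrict_restrict measurableSet_Icc]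
  calc ∫⁻ t in Icc (x - r) (x + r) ∩ s, ENNReal.ofReal (ω t)
      ≤ ∫⁻ t in Icc (x - r) (x + r), ENNReal.ofReal (ω t) :=
        lintegral_mono_set inter_subset_left
    _ ≤ ∫⁻ _ in Icc (x - r) (x + r), ENNReal.ofReal W :=
        setLIntegral_mono' measurableSet_Icc fun t ht => ENNReal.ofReal_le_ofReal (hW t ht)
    _ = ENNReal.ofReal (W * (2 * r)) := by
        rw [setLIntegral_const, Real.volume_Icc, ← ENNReal.ofReal_mul hW0]
        congr 2; ring

end SobolevData

/-! ### The main theorem. -/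

theorem theorem1 (S : SobolevData) (q : ℕ → Polynomial ℝ) (hq : S.IsOrthonormalSystem q)
    (h : ℝ → ℝ) (hbound : ∀ k, ∀ t ∈ S.eps, |(q k).eval t| ≤ h t)
    (hrec : Summable fun s : ℕ =>
      ∑ j ∈ Finset.Icc 1 (S.N + 1), (j : ℝ) * ∑ l ∈ Finset.Icc 0 (S.N + 1),
        (|S.recCoeff q (s + j) j - S.recCoeff q (s + j + l) j| +
          |S.recCoeff q (s + l) l - S.recCoeff q (s + j + l) l|))
    (φ : ℕ → ℝ) (hφ : IsQuasiconvex φ)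
    (hlog : φ =O[atTop] fun k : ℕ => 1 / Real.log (k : ℝ))
    (p : ℝ) (hp : 1 ≤ p) (f : ℝ → ℝ) (hf : S.MemR p f)
    (hfh : Integrable (fun t => |f t| ^ p * |h t| ^ p) S.θ)
    (hh : Integrable (fun t => |h t| ^ p) S.θ) :
    -- convergence at Lebesgue points
    (∀ x ∈ S.eps, (𝓝 x).IsBoundedUnder (· ≤ ·) h → IsLebesguePoint S.θ f x →
      ∃ T : ℝ, Tendsto (fun n => S.multSum q φ f n x) atTop (𝓝 T)) ∧
    -- convergence almost everywhere
    (∀ᵐ x ∂(volume : Measure ℝ), x ∈ S.eps →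
      ∃ T : ℝ, Tendsto (fun n => S.multSum q φ f n x) atTop (𝓝 T)) ∧
    -- uniform convergence on compact subsets
    (∀ ω : ℝ → ℝ, ContinuousOn f (Icc (-1) 1) →
      (∀ x ∈ S.eps, (𝓝 x).IsBoundedUnder (· ≤ ·) h) →
      ContinuousOn ω S.eps → (∀ x ∈ S.eps, 0 ≤ ω x) →
      S.θ = (volume.restrict (Icc (-1) 1)).withDensity (fun x => ENNReal.ofReal (ω x)) →
      ∃ T : ℝ → ℝ, ∀ K ⊆ S.eps, IsCompact K →
        TendstoUniformlyOn (fun n x => S.multSum q φ f n x) T atTop K) := by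
  have hfint : Integrable f S.θ := hf.1.integrable (by
    rw [← ENNReal.ofReal_one]; exact ENNReal.ofReal_le_ofReal hp)
  obtain ⟨g, hgh, hg, hfg, hqg⟩ := hq.exists_majorant hbound hp hfint hfh hh
  have hg0 : ∀ᵐ t ∂S.θ, 0 ≤ g t := hqg.mono fun t ht => (abs_nonneg _).trans (ht 0)
  -- The uniform result with K = {x} and V = h(x), so `h` need not be bounded near x. The free
  -- centre `c` serves both pointwise claims.
  have hpoint : ∀ x ∈ S.eps, ∀ c : ℝ, Tendsto
      (fun r : ℝ => r⁻¹ * ∫ t in Icc (x - r) (x + r), |f t - c| * g t ∂S.θ) (𝓝[>] 0) (𝓝 0) →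
      ∃ T : ℝ, Tendsto (fun n => S.multSum q φ f n x) atTop (𝓝 T) := by
    intro x hx c hlim
    obtain ⟨δ, c₁, K', hδ, hc₁, -, hK'e, hK', hw⟩ :=
      SobolevData.exists_uniform_neighbourhood (isCompact_singleton (x := x))
        (singleton_subset_iff.mpr hx)
    have hK'x := hK' x rfl
    obtain ⟨T, hT⟩ := hq.exists_tendstoUniformlyOn_multSum hrec hφ hlog hfint hg hfg hqg
      (K := {x}) (c := fun _ => c) (V := h x) (B := |c|) hδ
      (by rintro _ rfl; exact hK'x.trans hK'e) hc₁
      (by rintro _ rfl t ht; exact hw t (hK'x ht))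
      (by rintro _ rfl j; exact hbound j _ hx) (by rintro _ -; exact le_rfl) (by
        intro ε hε
        have hev := hlim.eventually (gt_mem_nhds hε)
        obtain ⟨ρ, hρ, hsub⟩ := mem_nhdsGT_iff_exists_Ioc_subset.mp hev
        refine ⟨ρ, hρ, ?_⟩
        rintro _ rfl r hr hrρ
        have h1 : r⁻¹ * _ < ε := hsub ⟨hr, hrρ⟩
        rw [inv_mul_lt_iff₀ hr] at h1
        linarith)
    exact ⟨T x, hT.tendsto_at rfl⟩
  refine ⟨fun x hx hhx hL => hpoint x hx (f x) ?_, ?_, ?_⟩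
  -- Near x the majorant is at most B, so a Lebesgue point for θ is one for gθ.
  · obtain ⟨B, hB⟩ := hhx
    obtain ⟨ρ, hρ, hsub⟩ := Metric.nhds_basis_closedBall.mem_iff.mp
      (inter_mem (eventually_map.mp hB) (S.isOpen_eps.mem_nhds hx))
    have hL' := Tendsto.const_mul |B| hL
    rw [mul_zero] at hL'
    refine squeeze_zero' ?_ ?_ hL'
    · filter_upwards [self_mem_nhdsWithin] with r hr
      refine mul_nonneg (inv_nonneg.mpr (le_of_lt hr)) (integral_nonneg_of_ae ?_)
      exact ae_restrict_of_ae (hg0.mono fun t ht => mul_nonneg (abs_nonneg _) ht)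
    · filter_upwards [Ioc_mem_nhdsGT hρ] with r hr
      rw [mul_left_comm]
      refine mul_le_mul_of_nonneg_left ?_ (inv_nonneg.mpr hr.1.le)
      rw [← integral_const_mul]
      have hi : Integrable (fun t => |f t - f x|) S.θ := (hfint.sub (integrable_const _)).abs
      refine integral_mono_of_nonneg
        (ae_restrict_of_ae (hg0.mono fun t ht => mul_nonneg (abs_nonneg _) ht))
        (hi.const_mul _).integrableOn ?_
      refine ae_restrict_of_forall_mem measurableSet_Icc fun t ht => ?_
      have htρ : t ∈ Metric.closedBall x ρ := by
        rw [Real.closedBall_eq_Icc]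
        exact ⟨by linarith [ht.1, hr.2], by linarith [ht.2, hr.2]⟩
      have h1 : h t ≤ B := (hsub htρ).1
      simp only
      rw [hgh t (hsub htρ).2, mul_comm]
      exact mul_le_mul_of_nonneg_right (h1.trans (le_abs_self B)) (abs_nonneg _)
  · filter_upwards [ae_exists_tendsto_inv_mul_setIntegral_abs_sub hfint.aestronglyMeasurable hg
      hg0 hfg] with x ⟨c, hc⟩ hx
    exact hpoint x hx c hc
  · intro ω hfc hhloc hωc hω0 hθ
    have hcompact : ∀ K ⊆ S.eps, IsCompact K → ∃ T : ℝ → ℝ,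
        TendstoUniformlyOn (fun n x => S.multSum q φ f n x) T atTop K := by
      intro K hKe hK
      obtain ⟨δ, c₁, K', hδ, hc₁, hK'c, hK'e, hK', hw⟩ :=
        SobolevData.exists_uniform_neighbourhood hK hKe
      obtain ⟨Bh, hBh⟩ := SobolevData.exists_forall_le_of_isBoundedUnder hK'c
        fun x hx => hhloc x (hK'e hx)
      obtain ⟨W, hW⟩ := hK'c.exists_bound_of_continuousOn (hωc.mono hK'e)
      have hIcc : S.eps ⊆ Icc (-1) 1 := fun t ht => Ioo_subset_Icc_self ht.1
      obtain ⟨B, hB⟩ := hK.exists_bound_of_continuousOn (hfc.mono (hKe.trans hIcc))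
      have hKK' : K ⊆ K' := fun x hx => hK' x hx ⟨by linarith, by linarith⟩
      have huc := isCompact_Icc.uniformContinuousOn_of_continuous hfc
      rw [Metric.uniformContinuousOn_iff] at huc
      refine hq.exists_tendstoUniformlyOn_multSum hrec hφ hlog hfint hg hfg hqg
        (K := K) (c := f) (V := Bh) (B := B) hδ (fun x hx => (hK' x hx).trans hK'e) hc₁
        (fun x hx t ht => hw t (hK' x hx ht))
        (fun x hx j => (hbound j x (hKe hx)).trans (hBh x (hKK' hx))) hB fun ε hε => ?_
      -- The interval of radius r has gθ-mass at most |Bh|·|W|·2r; oscillation ε/R then suffices,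
      -- and the +1 keeps R positive.
      set R := |Bh| * (|W| * 2) + 1 with hR
      have hR0 : 0 < R := by positivity
      obtain ⟨ρ, hρ, hosc⟩ := huc (ε / R) (by positivity)
      refine ⟨min δ (ρ / 2), by positivity, fun x hx r hr hrρ => ?_⟩
      have hrδ : r ≤ δ := hrρ.trans (min_le_left _ _)
      have hrρ' : r < ρ := by linarith [hrρ.trans (min_le_right _ _)]
      have hsub : Icc (x - r) (x + r) ⊆ K' := fun t ht =>
        hK' x hx ⟨by linarith [ht.1], by linarith [ht.2]⟩
      have hmass := SobolevData.measureReal_Icc_le_of_withDensity hθ hr.le (abs_nonneg W)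
        fun t ht => (le_abs_self _).trans ((hW t (hsub ht)).trans (le_abs_self W))
      have hnorm := norm_setIntegral_le_of_norm_le_const (μ := S.θ)
        (f := fun t => |f t - f x| * g t) (C := ε / R * |Bh|)
        (measure_lt_top S.θ (Icc (x - r) (x + r))) fun t ht => by
          have hte := hK'e (hsub ht)
          rw [Real.norm_eq_abs, abs_mul, abs_abs, hgh t hte,
            abs_of_nonneg ((abs_nonneg _).trans (hbound 0 t hte))]
          refine mul_le_mul (hosc t (hIcc hte) x (hIcc (hKe hx)) ?_).le
            ((hBh t (hsub ht)).trans (le_abs_self _))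
            ((abs_nonneg _).trans (hbound 0 t hte)) (by positivity)
          rw [Real.dist_eq, abs_lt]
          exact ⟨by linarith [ht.1], by linarith [ht.2]⟩
      refine (le_abs_self _).trans (hnorm.trans ?_)
      calc ε / R * |Bh| * S.θ.real (Icc (x - r) (x + r))
          ≤ ε / R * |Bh| * (|W| * (2 * r)) := mul_le_mul_of_nonneg_left hmass (by positivity)
        _ = ε / R * r * (|Bh| * (|W| * 2)) := by ring
        _ ≤ ε / R * r * R := mul_le_mul_of_nonneg_left (by linarith) (by positivity)
        _ = ε * r := by field_simp
    -- The limit is fixed pointwise through singletons, so that one T serves every K by uniqueness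
    -- of limits.
    have hlimit : ∀ x, ∃ T : ℝ, x ∈ S.eps →
        Tendsto (fun n => S.multSum q φ f n x) atTop (𝓝 T) := fun x => by
      by_cases hx : x ∈ S.eps
      · obtain ⟨T, hT⟩ := hcompact {x} (singleton_subset_iff.mpr hx) isCompact_singleton
        exact ⟨T x, fun _ => hT.tendsto_at rfl⟩
      · exact ⟨0, fun h => absurd h hx⟩
    choose T hT using hlimit
    refine ⟨T, fun K hKe hK => ?_⟩
    obtain ⟨T', hT'⟩ := hcompact K hKe hK
    exact hT'.congr_right fun x hx => tendsto_nhds_unique (hT'.tendsto_at hx) (hT x (hKe hx))
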